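/- Let $(\Omega,\mathcal F,\mathbb P)$ be a probability space carrying two independent processes: a real-valued centered Gaussian process $\{X(s)\}_{s\in[0,1]}$ whose trajectories are, for some $\alpha\in(1/2,1]$, almost surely $\alpha$-Hölder continuous on $[0,1]$, and a standard Brownian motion $\{W(s)\}_{s\in[0,1]}$. Let $\Phi:\mathbb R\to\mathbb R$ be continuously differentiable with $|\Phi(x)|+|\Phi'(x)|\le c(1+|x|)^L$ for all $x\in\mathbb R$, where $c,L>0$ are constants, and let $\{Z(t)\}_{t\in[0,1]}$ be a modification with almost surely continuous trajectories of the process given by the stochastic integral $$Z(t)=\int_0^t\Phi(X(s))\,dW(s),\qquad t\in[0,1].$$ For $t_0\in[0,1]$ let $\rho_Z(t_0)$ be the pointwise Hölder exponent of $Z$ at $t_0$, that is, $$\rho_Z(t_0)=\sup\Big\{\rho\in[0,1]\;:\;\limsup_{h\to0,\;h\neq0,\;t_0+h\in[0,1]}\frac{|Z(t_0+h)-Z(t_0)|}{|h|^{\rho}}=0\Big\}.$$ Assume that the set $\{x\in\mathbb R:\Phi(x)=0\}$ has Lebesgue measure zero. Then for every $t_0\in[0,1]$ with $\mathbb E|X(t_0)|^2>0$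 one has $$\mathbb P\big(\rho_Z(t_0)=1/2\big)=1.$$ -/

import Mathlib

open MeasureTheory ProbabilityTheory Filter Topology

noncomputable section

namespace StochVol

variable {Ω : Type*} {mΩ : MeasurableSpace Ω}

/-- A standard Brownian motion `{W t}`, `t ∈ [0, 1]`, on the measure space `(Ω, μ)`. -/
structure IsStandardBrownianMotion (W : unitInterval → Ω → ℝ) (μ : Measure Ω) : Prop where
  zero : ∀ᵐ ω ∂μ, W 0 ω = 0
  indep : HasIndepIncrements W μ
  law : ∀ s t : unitInterval, s ≤ t →
    HasLaw (fun ω => W t ω - W s ω) (gaussianReal 0 ((t : ℝ) - (s : ℝ)).toNNReal) μ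
  cont : ∀ᵐ ω ∂μ, Continuous (fun t => W t ω)

/-- The filtration `t ↦ σ(X s, s ∈ [0, 1]) ∨ σ(W u, u ≤ t)`.  When `X` and `W` are independent
and `W` is a Brownian motion, `W` is a Brownian motion for this filtration, and every process
of the form `Φ (X s)` is adapted to it. -/
def enlargedFiltration (X W : unitInterval → Ω → ℝ)
    (hX : ∀ s, Measurable (X s)) (hW : ∀ s, Measurable (W s)) : Filtration unitInterval mΩ :=
  Filtration.const unitInterval
      (⨆ s, MeasurableSpace.comap (X s) inferInstance) (iSup_le fun s => (hX s).comap_le)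
    ⊔ Filtration.natural W (fun s => (hW s).stronglyMeasurable)

/-- A simple (bounded, adapted, left-continuous, piecewise constant) integrand
`∑ i, ξ i * 1_{(τ i, τ (i + 1)]}`, where `ξ i` is `ℱ (τ i)`-measurable. -/
structure SimpleIntegrand (ℱ : Filtration unitInterval mΩ) where
  n : ℕ
  τ : Fin (n + 1) → unitInterval
  mono : Monotone τ
  ξ : Fin n → Ω → ℝ
  adapted : ∀ i, Measurable[ℱ (τ i.castSucc)] (ξ i)
  bounded : ∀ i, ∃ C : ℝ, ∀ ω, |ξ i ω| ≤ C

/-- The value at time `s` of a simple integrand. -/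
def SimpleIntegrand.eval {ℱ : Filtration unitInterval mΩ} (V : SimpleIntegrand ℱ)
    (s : unitInterval) (ω : Ω) : ℝ :=
  ∑ i, (Set.Ioc (V.τ i.castSucc) (V.τ i.succ)).indicator (fun _ => V.ξ i ω) s

/-- The elementary stochastic integral `∫₀ᵗ V dW` of a simple integrand. -/
def SimpleIntegrand.integral {ℱ : Filtration unitInterval mΩ} (V : SimpleIntegrand ℱ)
    (W : unitInterval → Ω → ℝ) (t : unitInterval) (ω : Ω) : ℝ :=
  ∑ i, V.ξ i ω * (W (min (V.τ i.succ) t) ω - W (min (V.τ i.castSucc) t) ω)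

/-- `Z t = ∫₀ᵗ H s dW s` for every `t ∈ [0, 1]`, in the sense of Itô: there are simple integrands
converging to `H` in `L²(Ω × [0, 1])` whose elementary integrals up to time `t` converge
to `Z t` in `L²(Ω)`, for every `t`.  This determines each `Z t` up to a null event. -/
def IsItoIntegral (ℱ : Filtration unitInterval mΩ) (μ : Measure Ω)
    (H W Z : unitInterval → Ω → ℝ) : Prop :=
  (∀ t, MemLp (Z t) 2 μ) ∧
  ∃ V : ℕ → SimpleIntegrand ℱ,
    Tendsto (fun n => ∫⁻ p : Ω × unitInterval,
        ‖(V n).eval p.2 p.1 - H p.2 p.1‖ₑ ^ 2 ∂(μ.prod volume)) atTop (𝓝 0) ∧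
    ∀ t, Tendsto (fun n => eLpNorm (fun ω => (V n).integral W t ω - Z t ω) 2 μ) atTop (𝓝 0)

/-- The pointwise Hölder exponent at `t₀` of a trajectory `y : [0, 1] → ℝ`: the supremum of the
`ρ ∈ [0, 1]` such that `limsup |y s - y t₀| / |s - t₀| ^ ρ = 0` as `s → t₀`, `s ≠ t₀`. -/
def pointwiseHolderExponent (y : unitInterval → ℝ) (t₀ : unitInterval) : ℝ :=
  sSup {ρ : ℝ | ρ ∈ Set.Icc (0 : ℝ) 1 ∧
    limsup (fun s : unitInterval =>
      ((|y s - y t₀| / |(s : ℝ) - (t₀ : ℝ)| ^ ρ : ℝ) : EReal)) (𝓝[≠] t₀) = 0}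

end StochVol

end

noncomputable section

namespace StochVol

open scoped ENNReal NNReal

/-! ### Independence of Brownian increments from the enlarged filtration. -/

section

/-! Near `t₀` the integrand can be frozen: `Z u - Z t₀` is `Φ (X t₀) * (W u - W t₀)` up to an error
whose `L²` norm is, after localization, of order `|u - t₀| ^ (α + 1/2)` by the Itô isometry. Divided
by `√|u - t₀|`, the error tends to zero in `L²`, hence almost surely along some sequence `u → t₀`.
The Brownian quotient is standard normal for every `u`, so along that sequence it almost surely
fails to tend to zero. As `X t₀` is a nondegenerate Gaussian variable and the zeros of `Φ` are
Lebesgue null, `Φ (X t₀) ≠ 0` almost surely; the exponent is therefore at most `1/2`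
(`IsItoIntegral.ae_not_tendsto_quotient`).

Conversely, where the integrand is bounded, Doob's inequality on the intervals of radius `2⁻ⁿ`
around `t₀` and Borel–Cantelli give a modulus of order `|u - t₀| ^ ρ` for each `ρ < 1/2`
(`IsItoIntegral.ae_eventually_abs_sub_le`).

Boundedness and the Hölder bound hold only on the events `tameEvent`, which exhaust `Ω` up to a null
set. The enlarged filtration contains the whole path of `X` at time `0`, so these events, and the
frozen value `Φ (X t₀)`, are known from the start. Multiplying by their indicators preserves
adaptedness, and freezing works on both sides of `t₀`. -/

theorem indep_sup_left_of_indep {Ω : Type*} {m₁ m₂ m₃ mΩ : MeasurableSpace Ω} {μ : Measure Ω}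
    [IsProbabilityMeasure μ] (h₁ : m₁ ≤ mΩ) (h₂ : m₂ ≤ mΩ) (h₃ : m₃ ≤ mΩ)
    (h₁₂₃ : Indep m₁ (m₂ ⊔ m₃) μ) (h₂₃ : Indep m₂ m₃ μ) : Indep (m₁ ⊔ m₂) m₃ μ := by
  -- The intersections `a ∩ b` form a π-system generating `m₁ ⊔ m₂`, and on them the product formula
  -- follows by splitting off `a` first.
  refine IndepSets.indep (p1 := Set.image2 (· ∩ ·) {s | MeasurableSet[m₁] s}
    {s | MeasurableSet[m₂] s}) (p2 := {s | MeasurableSet[m₃] s}) (sup_le h₁ h₂) h₃ ?_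
    (@MeasurableSpace.isPiSystem_measurableSet Ω m₃) ?_
    (@MeasurableSpace.generateFrom_measurableSet Ω m₃).symm ?_
  · rintro _ ⟨a, ha, b, hb, rfl⟩ _ ⟨c, hc, d, hd, rfl⟩ -
    refine ⟨a ∩ c, MeasurableSet.inter ha hc, b ∩ d, MeasurableSet.inter hb hd, ?_⟩
    exact Set.inter_inter_inter_comm a c b d
  · refine le_antisymm (sup_le ?_ ?_) (MeasurableSpace.generateFrom_le ?_)
    · intro s hs
      exact MeasurableSpace.measurableSet_generateFrom
        ⟨s, hs, Set.univ, MeasurableSet.univ, Set.inter_univ s⟩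
    · intro s hs
      exact MeasurableSpace.measurableSet_generateFrom
        ⟨Set.univ, MeasurableSet.univ, s, hs, Set.univ_inter s⟩
    · rintro _ ⟨a, ha, b, hb, rfl⟩
      exact MeasurableSet.inter ((le_sup_left : m₁ ≤ m₁ ⊔ m₂) a ha)
        ((le_sup_right : m₂ ≤ m₁ ⊔ m₂) b hb)
  · rw [IndepSets_iff]
    rintro _ t ⟨a, ha, b, hb, rfl⟩ ht
    have hbt : MeasurableSet[m₂ ⊔ m₃] (b ∩ t) :=
      MeasurableSet.inter ((le_sup_left : m₂ ≤ m₂ ⊔ m₃) b hb) ((le_sup_right : m₃ ≤ m₂ ⊔ m₃) t ht)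
    rw [Indep_iff] at h₁₂₃ h₂₃
    rw [Set.inter_assoc, h₁₂₃ a _ ha hbt, h₂₃ b t hb ht,
      h₁₂₃ a b ha ((le_sup_left : m₂ ≤ m₂ ⊔ m₃) b hb), mul_assoc]

variable {Ω : Type*} {mΩ : MeasurableSpace Ω} {μ : Measure Ω} {X W : unitInterval → Ω → ℝ}

theorem IsStandardBrownianMotion.hasGaussianLaw (hW : IsStandardBrownianMotion W μ)
    (t : unitInterval) : HasGaussianLaw (W t) μ := by
  refine (hW.law 0 t bot_le).hasGaussianLaw.congr ?_
  filter_upwards [hW.zero] with ω hω using by simp [hω]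

theorem IsStandardBrownianMotion.isGaussianProcess (hW : IsStandardBrownianMotion W μ) :
    IsGaussianProcess W μ :=
  hW.indep.isGaussianProcess hW.hasGaussianLaw hW.zero

/-- The past and the increment are jointly Gaussian, so zero covariances suffice. For `r ≤ s`, write
`W t - W s` as `(W t - W r) - (W s - W r)`; both terms are independent of `W r`. -/
theorem IsStandardBrownianMotion.indepFun_past [IsProbabilityMeasure μ]
    (hW : IsStandardBrownianMotion W μ)
    {s t : unitInterval} (hst : s ≤ t) :
    IndepFun (fun ω (r : Set.Iic s) => W r ω) (fun ω (_ : Unit) => W t ω - W s ω) μ := by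
  have hL2 : ∀ r, MemLp (W r) 2 μ := fun r => (hW.hasGaussianLaw r).memLp_two
  refine IsGaussianProcess.indepFun_of_covariance_eq_zero ?_
    (fun r => (hW.hasGaussianLaw r).aemeasurable)
    (fun _ => ((hW.hasGaussianLaw t).aemeasurable.sub (hW.hasGaussianLaw s).aemeasurable)) ?_
  · apply hW.isGaussianProcess.of_isGaussianProcess
    rintro (⟨r, hr⟩ | _)
    · exact ⟨{r},
        { toFun x := x ⟨r, by simp⟩
          map_add' x y := by simp
          map_smul' c x := by simp }, by simp⟩
    · exact ⟨{s, t},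
        { toFun x := x ⟨t, by simp⟩ - x ⟨s, by simp⟩
          map_add' x y := by simp; abel
          map_smul' c x := by simp; ring }, by simp⟩
  · rintro ⟨r, hr : r ≤ s⟩ _
    have h1 := (hW.indep.indepFun_eval_sub (r := 0) (s := r) (t := t) bot_le (hr.trans hst)
      hW.zero).covariance_eq_zero (hL2 r) ((hL2 t).sub (hL2 r))
    have h2 := (hW.indep.indepFun_eval_sub (r := 0) (s := r) (t := s) bot_le hr
      hW.zero).covariance_eq_zero (hL2 r) ((hL2 s).sub (hL2 r))
    have : (fun ω => W t ω - W s ω) = (W t - W r) - (W s - W r) := by ext; simp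
    rw [this, covariance_sub_right (hL2 r) ((hL2 t).sub (hL2 r)) ((hL2 s).sub (hL2 r)), h1, h2,
      sub_zero]

theorem iSup_comap_eq_comap_pi {ι : Type*} (Y : ι → Ω → ℝ) :
    ⨆ i, MeasurableSpace.comap (Y i) inferInstance =
      MeasurableSpace.comap (fun ω i => Y i ω) inferInstance := by
  simp only [MeasurableSpace.pi, MeasurableSpace.comap_iSup, MeasurableSpace.comap_comp]
  rfl

/-- Increments of `W` after time `s` are independent of the enlarged filtration at time `s`. -/
theorem indep_enlargedFiltration [IsProbabilityMeasure μ] (hXm : ∀ s, Measurable (X s)) (hWm : ∀ s, Measurable (W s))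
    (hW : IsStandardBrownianMotion W μ)
    (hXW : IndepFun (fun ω s => X s ω) (fun ω s => W s ω) μ)
    {s t : unitInterval} (hst : s ≤ t) :
    Indep (enlargedFiltration X W hXm hWm s)
      (MeasurableSpace.comap (fun ω => W t ω - W s ω) inferInstance) μ := by
  have hinc : MeasurableSpace.comap (fun ω => W t ω - W s ω) inferInstance =
      MeasurableSpace.comap (fun ω (_ : Unit) => W t ω - W s ω) inferInstance := by
    rw [← iSup_comap_eq_comap_pi]; simp
  have hpast : Filtration.natural W (fun s => (hWm s).stronglyMeasurable) s =
      MeasurableSpace.comap (fun ω (r : Set.Iic s) => W r ω) inferInstance := by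
    rw [← iSup_comap_eq_comap_pi, iSup_subtype]; rfl
  have hminc : Measurable (fun ω => W t ω - W s ω) := (hWm t).sub (hWm s)
  refine indep_sup_left_of_indep (iSup_le fun s => (hXm s).comap_le)
    (Filtration.le _ s) hminc.comap_le ?_ ?_
  · have h := IndepFun_iff_Indep .. |>.1 hXW
    refine indep_of_indep_of_le h (iSup_comap_eq_comap_pi X).le (sup_le ?_ ?_)
    · rw [← iSup_comap_eq_comap_pi]
      exact iSup₂_le fun r _ => le_iSup (fun i => MeasurableSpace.comap (W i) inferInstance) r
    · rw [← measurable_iff_comap_le, ← iSup_comap_eq_comap_pi]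
      exact ((measurable_iff_comap_le.2 (le_iSup (fun i => MeasurableSpace.comap (W i)
        inferInstance) t)).sub (measurable_iff_comap_le.2 (le_iSup (fun i =>
          MeasurableSpace.comap (W i) inferInstance) s)))
  · rw [hinc, hpast]
    exact IndepFun_iff_Indep .. |>.1 (hW.indepFun_past hst)

end

/-! ### Discrete stochastic integrals: isometry, orthogonality and Doob's inequality. -/

section

/-- `W` is a standard Brownian motion relative to the filtration `ℱ`. -/
structure IsBrownianRelativeTo {Ω : Type*} {mΩ : MeasurableSpace Ω}
    (ℱ : Filtration unitInterval mΩ) (W : unitInterval → Ω → ℝ) (μ : Measure Ω) : Prop where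
  adapted : ∀ t, Measurable[ℱ t] (W t)
  law : ∀ s t : unitInterval, s ≤ t →
    HasLaw (fun ω => W t ω - W s ω) (gaussianReal 0 ((t : ℝ) - (s : ℝ)).toNNReal) μ
  indep : ∀ s t, s ≤ t →
    Indep (ℱ s) (MeasurableSpace.comap (fun ω => W t ω - W s ω) inferInstance) μ

variable {Ω : Type*} {mΩ : MeasurableSpace Ω} {μ : Measure Ω} {X W : unitInterval → Ω → ℝ}
  {ℱ : Filtration unitInterval mΩ}

theorem IsStandardBrownianMotion.isBrownianRelativeTo [IsProbabilityMeasure μ]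
    (hXm : ∀ s, Measurable (X s)) (hWm : ∀ s, Measurable (W s))
    (hW : IsStandardBrownianMotion W μ)
    (hXW : IndepFun (fun ω s => X s ω) (fun ω s => W s ω) μ) :
    IsBrownianRelativeTo (enlargedFiltration X W hXm hWm) W μ where
  adapted t := by
    refine Measurable.mono (measurable_iff_comap_le.2 le_rfl) (le_trans ?_
      (le_sup_right : _ ≤ enlargedFiltration X W hXm hWm t)) le_rfl
    exact le_iSup₂_of_le (f := fun j (_ : j ≤ t) => MeasurableSpace.comap (W j) inferInstance)
      t le_rfl le_rfl
  law := hW.law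
  indep _ _ hst := indep_enlargedFiltration hXm hWm hW hXW hst

namespace IsBrownianRelativeTo

variable (hW : IsBrownianRelativeTo ℱ W μ)
include hW

theorem measurable (t : unitInterval) : Measurable (W t) := (hW.adapted t).mono (ℱ.le t) le_rfl

theorem memLp_increment {s t : unitInterval} (hst : s ≤ t) :
    MemLp (fun ω => W t ω - W s ω) 2 μ :=
  (hW.law s t hst).hasGaussianLaw.memLp_two

theorem integral_increment {s t : unitInterval} (hst : s ≤ t) :
    ∫ ω, (W t ω - W s ω) ∂μ = 0 := by
  have := (hW.law s t hst).integral_eq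
  simpa using this

theorem integral_increment_sq {s t : unitInterval} (hst : s ≤ t) :
    ∫ ω, (W t ω - W s ω) ^ 2 ∂μ = (t : ℝ) - s := by
  have h := (hW.law s t hst).variance_eq
  rw [variance_eq_integral (hW.law s t hst).aemeasurable] at h
  simp only [hW.integral_increment hst, sub_zero, variance_id_gaussianReal] at h
  rw [h, Real.coe_toNNReal _ (sub_nonneg.2 hst)]

theorem indepFun {s t : unitInterval} (hst : s ≤ t) {ζ : Ω → ℝ} (hζ : Measurable[ℱ s] ζ) :
    IndepFun ζ (fun ω => W t ω - W s ω) μ := by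
  rw [IndepFun_iff_Indep]
  exact indep_of_indep_of_le_left (hW.indep s t hst) (measurable_iff_comap_le.1 hζ)

theorem integral_mul_increment {s t : unitInterval} (hst : s ≤ t) {ζ : Ω → ℝ}
    (hζ : Measurable[ℱ s] ζ) : ∫ ω, ζ ω * (W t ω - W s ω) ∂μ = 0 := by
  rw [(hW.indepFun hst hζ).integral_fun_mul_eq_mul_integral
    (hζ.mono (ℱ.le s) le_rfl).aestronglyMeasurable
    (hW.memLp_increment hst).aestronglyMeasurable, hW.integral_increment hst, mul_zero]

theorem memLp_mul_increment {s t : unitInterval} (hst : s ≤ t) {ζ : Ω → ℝ}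
    (hζ : Measurable[ℱ s] ζ) (hζ2 : MemLp ζ 2 μ) :
    MemLp (fun ω => ζ ω * (W t ω - W s ω)) 2 μ := by
  have hm : AEStronglyMeasurable (fun ω => ζ ω * (W t ω - W s ω)) μ :=
    hζ2.aestronglyMeasurable.mul (hW.memLp_increment hst).aestronglyMeasurable
  rw [memLp_two_iff_integrable_sq hm]
  have h := (hW.indepFun hst hζ).comp (measurable_id.pow_const 2) (measurable_id.pow_const 2)
  have := h.integrable_mul hζ2.integrable_sq (hW.memLp_increment hst).integrable_sq
  refine this.congr (ae_of_all _ fun ω => ?_)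
  simp [mul_pow]

/-- Independence makes this an exact identity: the squares of `ζ` and of the increment are
independent too, so the expectation factors. -/
theorem integral_mul_increment_sq {s t : unitInterval} (hst : s ≤ t) {ζ : Ω → ℝ}
    (hζ : Measurable[ℱ s] ζ) :
    ∫ ω, (ζ ω * (W t ω - W s ω)) ^ 2 ∂μ = (∫ ω, ζ ω ^ 2 ∂μ) * ((t : ℝ) - s) := by
  have h := (hW.indepFun hst hζ).comp (measurable_id.pow_const 2) (measurable_id.pow_const 2)
  have h' := h.integral_fun_mul_eq_mul_integral
    ((hζ.mono (ℱ.le s) le_rfl).pow_const 2).aestronglyMeasurable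
    ((hW.memLp_increment hst).aestronglyMeasurable.pow 2)
  simp only [Function.comp_apply, id_eq, hW.integral_increment_sq hst] at h'
  simpa only [mul_pow] using h'

end IsBrownianRelativeTo

/-- The discrete stochastic integral `∑_{k < n} η k * (W (σ (k + 1)) - W (σ k))`. -/
def discreteIntegral (W : unitInterval → Ω → ℝ) (σ : ℕ → unitInterval) (η : ℕ → Ω → ℝ)
    (n : ℕ) (ω : Ω) : ℝ :=
  ∑ k ∈ Finset.range n, η k ω * (W (σ (k + 1)) ω - W (σ k) ω)

namespace IsBrownianRelativeTo

variable (hW : IsBrownianRelativeTo ℱ W μ) {σ : ℕ → unitInterval} (hσ : Monotone σ)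
  {η : ℕ → Ω → ℝ} (hη : ∀ k, Measurable[ℱ (σ k)] (η k)) (hη2 : ∀ k, MemLp (η k) 2 μ)
include hW hσ hη

theorem measurable_discreteIntegral (n : ℕ) :
    Measurable[ℱ (σ n)] (discreteIntegral W σ η n) := by
  unfold discreteIntegral
  refine Finset.measurable_fun_sum _ fun k hk => ?_
  have hkn : k + 1 ≤ n := Finset.mem_range.1 hk
  have h0 : σ k ≤ σ n := hσ (by omega)
  exact ((hη k).mono (ℱ.mono h0) le_rfl).mul
    (((hW.adapted _).mono (ℱ.mono (hσ hkn)) le_rfl).sub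
      ((hW.adapted _).mono (ℱ.mono h0) le_rfl))

include hη2

theorem memLp_discreteIntegral (n : ℕ) : MemLp (discreteIntegral W σ η n) 2 μ := by
  unfold discreteIntegral
  exact memLp_finsetSum _ fun k _ =>
    hW.memLp_mul_increment (hσ (Nat.le_succ k)) (hη k) (hη2 k)

theorem integral_mul_discreteIntegral {ζ : Ω → ℝ} (hζ : Measurable[ℱ (σ 0)] ζ)
    (hζ2 : MemLp ζ 2 μ) (n : ℕ) : ∫ ω, ζ ω * discreteIntegral W σ η n ω ∂μ = 0 := by
  unfold discreteIntegral
  simp_rw [Finset.mul_sum]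
  have hint : ∀ k ∈ Finset.range n,
      Integrable (fun ω => ζ ω * (η k ω * (W (σ (k + 1)) ω - W (σ k) ω))) μ := fun k _ =>
    hζ2.integrable_mul (hW.memLp_mul_increment (hσ (Nat.le_succ k)) (hη k) (hη2 k))
  rw [integral_finsetSum _ hint]
  refine Finset.sum_eq_zero fun k _ => ?_
  simp_rw [← mul_assoc]
  exact hW.integral_mul_increment (hσ (Nat.le_succ k)) (ζ := fun ω => ζ ω * η k ω)
    ((hζ.mono (ℱ.mono (hσ (Nat.zero_le k))) le_rfl).mul (hη k))

/-- Cross terms vanish because the partial sum times the next coefficient is measurable before the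
next increment, which is independent of it and centered. -/
theorem integral_discreteIntegral_sq (n : ℕ) :
    ∫ ω, discreteIntegral W σ η n ω ^ 2 ∂μ =
      ∑ k ∈ Finset.range n, (∫ ω, η k ω ^ 2 ∂μ) * ((σ (k + 1) : ℝ) - σ k) := by
  induction n with
  | zero => simp [discreteIntegral]
  | succ n ih =>
    have hle : σ n ≤ σ (n + 1) := hσ (Nat.le_succ n)
    have hS := hW.memLp_discreteIntegral hσ hη hη2 n
    have hI := hW.memLp_mul_increment hle (hη n) (hη2 n)
    have hcross : ∫ ω, discreteIntegral W σ η n ω * (η n ω * (W (σ (n + 1)) ω - W (σ n) ω)) ∂μ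
        = 0 := by
      simp_rw [← mul_assoc]
      exact hW.integral_mul_increment hle
        (ζ := fun ω => discreteIntegral W σ η n ω * η n ω)
        ((hW.measurable_discreteIntegral hσ hη n).mul (hη n))
    have hexp : ∀ ω, discreteIntegral W σ η (n + 1) ω ^ 2 = discreteIntegral W σ η n ω ^ 2
        + 2 * (discreteIntegral W σ η n ω * (η n ω * (W (σ (n + 1)) ω - W (σ n) ω)))
        + (η n ω * (W (σ (n + 1)) ω - W (σ n) ω)) ^ 2 := fun ω => by
      simp only [discreteIntegral, Finset.sum_range_succ]; ring
    have hc : Integrable (fun ω => 2 * (discreteIntegral W σ η n ω *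
        (η n ω * (W (σ (n + 1)) ω - W (σ n) ω)))) μ := (hS.integrable_mul hI).const_mul 2
    have hSc : Integrable (fun ω => discreteIntegral W σ η n ω ^ 2 +
        2 * (discreteIntegral W σ η n ω * (η n ω * (W (σ (n + 1)) ω - W (σ n) ω)))) μ :=
      hS.integrable_sq.add hc
    simp_rw [hexp]
    rw [integral_add hSc hI.integrable_sq, integral_add hS.integrable_sq hc, integral_const_mul,
      hcross, ih, hW.integral_mul_increment_sq hle (hη n), Finset.sum_range_succ]
    ring

end IsBrownianRelativeTo

/-- Doob's `L²` maximal inequality for a square integrable martingale. -/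
theorem measure_exists_le_abs_le [IsFiniteMeasure μ] {𝒢 : Filtration ℕ mΩ} {M : ℕ → Ω → ℝ}
    (hM : ∀ k, Measurable[𝒢 k] (M k)) (hM2 : ∀ k, MemLp (M k) 2 μ)
    (horth : ∀ k (ζ : Ω → ℝ), Measurable[𝒢 k] ζ → MemLp ζ 2 μ →
      ∫ ω, ζ ω * (M (k + 1) ω - M k ω) ∂μ = 0) {r : ℝ} (hr : 0 < r) (n : ℕ) :
    ENNReal.ofReal (r ^ 2) * μ {ω | ∃ k ≤ n, r ≤ |M k ω|} ≤
      ENNReal.ofReal (∫ ω, M n ω ^ 2 ∂μ) := by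
  -- Testing orthogonality against `ζ = 1_A * M k` removes the cross term in the expansion of `M (k
  -- + 1) ^ 2` over `A`, leaving a nonnegative square.
  have hsub : Submartingale (fun k ω => M k ω ^ 2) 𝒢 μ := by
    refine submartingale_of_setIntegral_le_succ
      (fun k => ((hM k).pow_const 2).stronglyMeasurable) (fun k => (hM2 k).integrable_sq)
      fun k A hA => ?_
    have hA' : MeasurableSet A := 𝒢.le k A hA
    have h0 := horth k (A.indicator (M k)) ((hM k).indicator hA) ((hM2 k).indicator hA')
    have hd := (hM2 (k + 1)).sub (hM2 k)
    have hζ : (fun ω => A.indicator (M k) ω * (M (k + 1) ω - M k ω)) =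
        A.indicator (fun ω => M k ω * (M (k + 1) ω - M k ω)) := by
      ext ω; by_cases h : ω ∈ A <;> simp [h]
    rw [hζ, integral_indicator hA'] at h0
    have hexp : ∀ ω, M (k + 1) ω ^ 2 = M k ω ^ 2 + 2 * (M k ω * (M (k + 1) ω - M k ω))
        + (M (k + 1) ω - M k ω) ^ 2 := fun ω => by ring
    have hc : Integrable (fun ω => M k ω * (M (k + 1) ω - M k ω)) μ := (hM2 k).integrable_mul hd
    have hsq : Integrable (fun ω => (M (k + 1) ω - M k ω) ^ 2) μ := hd.integrable_sq
    have hMc : Integrable (fun ω => M k ω ^ 2 + 2 * (M k ω * (M (k + 1) ω - M k ω))) μ :=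
      (hM2 k).integrable_sq.add (hc.const_mul 2)
    simp_rw [hexp]
    rw [integral_add hMc.integrableOn hsq.integrableOn,
      integral_add (hM2 k).integrable_sq.integrableOn (hc.const_mul 2).integrableOn,
      integral_const_mul, h0]
    have : 0 ≤ ∫ ω in A, (M (k + 1) ω - M k ω) ^ 2 ∂μ :=
      integral_nonneg fun ω => sq_nonneg _
    linarith
  have h := maximal_ineq hsub (fun k ω => sq_nonneg (M k ω)) (ε := (r ^ 2).toNNReal) n
  have hset : {ω | ∃ k ≤ n, r ≤ |M k ω|} = {ω | (((r ^ 2).toNNReal : ℝ≥0) : ℝ) ≤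
      (Finset.range (n + 1)).sup' Finset.nonempty_range_add_one fun k => M k ω ^ 2} := by
    ext ω
    simp only [Set.mem_ofPred_eq, Finset.le_sup'_iff, Finset.mem_range, Nat.lt_succ_iff,
      Real.coe_toNNReal _ (sq_nonneg r), sq_le_sq, abs_of_pos hr]
  rw [hset]
  refine h.trans (ENNReal.ofReal_le_ofReal ?_)
  exact setIntegral_le_integral (hM2 n).integrable_sq (ae_of_all _ fun ω => sq_nonneg _)

end

/-! ### Elementary integrals as discrete integrals, and the localized Itô isometry. -/

section

variable {Ω : Type*} {mΩ : MeasurableSpace Ω} {μ : Measure Ω} {W : unitInterval → Ω → ℝ}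
  {ℱ : Filtration unitInterval mΩ}

theorem sum_indicator_Ioc {T E : Type*} [LinearOrder T] [AddCommMonoid E] {σ : ℕ → T}
    (hσ : Monotone σ) (f : T → E) (n : ℕ) (u : T) :
    ∑ k ∈ Finset.range n, (Set.Ioc (σ k) (σ (k + 1))).indicator f u =
      (Set.Ioc (σ 0) (σ n)).indicator f u := by
  induction n with
  | zero => simp
  | succ n ih =>
    rw [Finset.sum_range_succ, ih, ← Set.Ioc_union_Ioc_eq_Ioc (hσ (Nat.zero_le n))
      (hσ (Nat.le_succ n)), Set.indicator_union_of_disjoint]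
    exact Set.Ioc_disjoint_Ioc_of_le le_rfl

namespace SimpleIntegrand

variable (V : SimpleIntegrand ℱ)

/-- No partition point of `V` lies in the open interval `(a, b)`. -/
def NoNodeBetween (a b : unitInterval) : Prop := ∀ i, V.τ i ≤ a ∨ b ≤ V.τ i

open Classical in
/-- The value of `V` on `(a, b]`, when no partition point lies in `(a, b)`. -/
def valueOn (a b : unitInterval) (ω : Ω) : ℝ := if a < b then V.eval b ω else 0

variable {V} {a b : unitInterval}

/-- A step interval of `V` containing `b` starts before `b`, hence at or before `a` as no node lies
in between; its coefficient is already known at time `a`. -/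
theorem NoNodeBetween.measurable_valueOn (h : V.NoNodeBetween a b) :
    Measurable[ℱ a] (V.valueOn a b) := by
  unfold valueOn
  split_ifs with hab
  · unfold eval
    refine Finset.measurable_fun_sum _ fun i _ => ?_
    by_cases hb : b ∈ Set.Ioc (V.τ i.castSucc) (V.τ i.succ)
    · simp only [Set.indicator_of_mem hb]
      exact (V.adapted i).mono (ℱ.mono ((h _).resolve_right (not_le.2 hb.1))) le_rfl
    · simp only [Set.indicator_of_notMem hb]
      exact measurable_const
  · exact measurable_const

theorem exists_abs_eval_le (V : SimpleIntegrand ℱ) :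
    ∃ C : ℝ, ∀ u ω, |V.eval u ω| ≤ C := by
  choose C hC using V.bounded
  refine ⟨∑ i, C i, fun u ω => ?_⟩
  refine (Finset.abs_sum_le_sum_abs _ _).trans (Finset.sum_le_sum fun i _ => ?_)
  refine le_trans ?_ (hC i ω)
  by_cases hb : u ∈ Set.Ioc (V.τ i.castSucc) (V.τ i.succ) <;> simp [hb]

theorem exists_abs_valueOn_le (V : SimpleIntegrand ℱ) :
    ∃ C : ℝ, ∀ a b ω, |V.valueOn a b ω| ≤ C := by
  obtain ⟨C, hC⟩ := V.exists_abs_eval_le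
  refine ⟨max C 0, fun a b ω => ?_⟩
  unfold valueOn
  split_ifs
  · exact (hC b ω).trans (le_max_left _ _)
  · simp

theorem NoNodeBetween.eval_eq (h : V.NoNodeBetween a b) {u : unitInterval}
    (hu : u ∈ Set.Ioc a b) (ω : Ω) : V.eval u ω = V.valueOn a b ω := by
  rw [valueOn, if_pos (hu.1.trans_le hu.2)]
  unfold eval
  refine Finset.sum_congr rfl fun i _ => ?_
  have : u ∈ Set.Ioc (V.τ i.castSucc) (V.τ i.succ) ↔ b ∈ Set.Ioc (V.τ i.castSucc) (V.τ i.succ) := by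
    have h1 := h i.castSucc
    have h2 := h i.succ
    have h3 := hu.1
    have h4 := hu.2
    simp only [Set.mem_Ioc]
    grind
  by_cases hb : b ∈ Set.Ioc (V.τ i.castSucc) (V.τ i.succ)
  · rw [Set.indicator_of_mem hb, Set.indicator_of_mem (this.2 hb)]
  · rw [Set.indicator_of_notMem hb, Set.indicator_of_notMem (mt this.1 hb)]

theorem NoNodeBetween.integral_sub (h : V.NoNodeBetween a b) (hab : a ≤ b) (ω : Ω) :
    V.integral W b ω - V.integral W a ω = V.valueOn a b ω * (W b ω - W a ω) := by
  rcases hab.eq_or_lt with rfl | hab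
  · simp
  rw [valueOn, if_pos hab]
  unfold integral eval
  rw [← Finset.sum_sub_distrib, Finset.sum_mul]
  refine Finset.sum_congr rfl fun i _ => ?_
  have hm : V.τ i.castSucc ≤ V.τ i.succ := V.mono (Fin.castSucc_le_succ i)
  rcases h i.castSucc with h1 | h1
  · rcases h i.succ with h2 | h2
    · have hb : b ∉ Set.Ioc (V.τ i.castSucc) (V.τ i.succ) := fun hb =>
        absurd (hab.trans_le hb.2) (not_lt.2 h2)
      rw [Set.indicator_of_notMem hb, min_eq_left (h2.trans hab.le), min_eq_left (h1.trans hab.le),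
        min_eq_left h2, min_eq_left h1]
      ring
    · have hb : b ∈ Set.Ioc (V.τ i.castSucc) (V.τ i.succ) := ⟨h1.trans_lt hab, h2⟩
      rw [Set.indicator_of_mem hb, min_eq_right h2, min_eq_left (h1.trans hab.le),
        min_eq_right (hab.le.trans h2), min_eq_left h1]
      ring
  · have hb : b ∉ Set.Ioc (V.τ i.castSucc) (V.τ i.succ) := fun hb => absurd hb.1 (not_lt.2 h1)
    rw [Set.indicator_of_notMem hb, min_eq_right (h1.trans hm), min_eq_right h1,
      min_eq_right ((hab.le.trans h1).trans hm), min_eq_right (hab.le.trans h1)]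
    ring

variable (V) in
/-- The partition of `[s, t]` induced by the partition points of `V`. -/
def partition (s t : unitInterval) : ℕ → unitInterval
  | 0 => s
  | k + 1 => if h : k < V.n + 1 then max s (min (V.τ ⟨k, h⟩) t) else t

variable {s t : unitInterval}

/-- Index `0` is `s` and indices `1` to `V.n + 1` are the nodes clamped to `[s, t]`, so index `V.n +
2` is the first one that is `t` by default. -/
theorem partition_end : V.partition s t (V.n + 2) = t := by
  simp [partition]

theorem le_partition (hst : s ≤ t) (k : ℕ) : s ≤ V.partition s t k := by
  cases k with
  | zero => exact le_rfl
  | succ k => rw [partition]; split_ifs; exacts [le_max_left _ _, hst]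

theorem partition_le (hst : s ≤ t) (k : ℕ) : V.partition s t k ≤ t := by
  cases k with
  | zero => exact hst
  | succ k => rw [partition]; split_ifs; exacts [max_le hst (min_le_right _ _), le_rfl]

theorem monotone_partition (hst : s ≤ t) : Monotone (V.partition s t) := by
  refine monotone_nat_of_le_succ fun k => ?_
  cases k with
  | zero => exact le_partition hst _
  | succ k =>
    by_cases h : k + 1 < V.n + 1
    · simp only [partition, dif_pos h, dif_pos (show k < V.n + 1 by omega)]
      exact max_le_max le_rfl (min_le_min (V.mono (Fin.mk_le_mk.2 (Nat.le_succ k))) le_rfl)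
    · have : V.partition s t (k + 1 + 1) = t := by simp only [partition, dif_neg h]
      rw [this]
      exact partition_le hst _

/-- A node strictly between two consecutive points would lie in `(s, t)`, so clamping would leave it
unchanged and it would itself be a point of the partition, against monotonicity. -/
theorem noNodeBetween_partition (hst : s ≤ t) (k : ℕ) :
    V.NoNodeBetween (V.partition s t k) (V.partition s t (k + 1)) := by
  intro i
  have hi : V.partition s t (i + 1) = max s (min (V.τ i) t) := by
    rw [partition, dif_pos i.2]
  by_contra! hcon
  have h1 := (le_partition hst k).trans_lt hcon.1
  have h2 := hcon.2.trans_le (partition_le hst _)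
  rw [min_eq_left h2.le, max_eq_right h1.le] at hi
  rw [← hi] at hcon
  rcases Nat.lt_or_ge k (i + 1) with hk | hk
  · exact absurd hcon.2 (not_lt.2 (monotone_partition hst hk))
  · exact absurd hcon.1 (not_lt.2 (monotone_partition hst hk))

/-- Elementary stochastic integrals over `[s, t]`, localized on an event `B` and recentered,
as discrete integrals. -/
theorem indicator_integral_sub_eq (hst : s ≤ t) (B : Set Ω) (ξ : Ω → ℝ) :
    B.indicator (fun ω => V.integral W t ω - V.integral W s ω - ξ ω * (W t ω - W s ω)) =
      discreteIntegral W (V.partition s t)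
        (fun k => B.indicator (V.valueOn (V.partition s t k) (V.partition s t (k + 1)) - ξ))
        (V.n + 2) := by
  ext ω
  have hsum (f : unitInterval → ℝ) : ∑ k ∈ Finset.range (V.n + 2),
      (f (V.partition s t (k + 1)) - f (V.partition s t k)) = f t - f s := by
    rw [Finset.sum_range_sub (fun k => f (V.partition s t k)), partition_end]; rfl
  unfold discreteIntegral
  by_cases hB : ω ∈ B
  · simp only [Set.indicator_of_mem hB, Pi.sub_apply, sub_mul]
    rw [Finset.sum_sub_distrib, ← Finset.mul_sum, hsum (fun u => W u ω),
      ← hsum (fun u => V.integral W u ω)]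
    congr 1
    exact Finset.sum_congr rfl fun k _ => (noNodeBetween_partition hst k).integral_sub
      (monotone_partition hst (Nat.le_succ k)) ω
  · simp [hB]

theorem indicator_integral_sub_eq' (hst : s ≤ t) (B : Set Ω) :
    B.indicator (fun ω => V.integral W t ω - V.integral W s ω) =
      discreteIntegral W (V.partition s t) (fun k => B.indicator
        (V.valueOn (V.partition s t k) (V.partition s t (k + 1)) - fun _ => 0)) (V.n + 2) := by
  rw [← indicator_integral_sub_eq hst]
  simp

variable {B : Set Ω} {ξ : Ω → ℝ}

/-- `B` and `ξ` are known at time `0`, so localizing and recentering keep the coefficients adapted.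
-/
theorem measurable_coefficient (hst : s ≤ t) (hB : MeasurableSet[ℱ 0] B)
    (hξ : Measurable[ℱ 0] ξ) (k : ℕ) : Measurable[ℱ (V.partition s t k)]
      (B.indicator (V.valueOn (V.partition s t k) (V.partition s t (k + 1)) - ξ)) :=
  ((noNodeBetween_partition hst k).measurable_valueOn.sub
    (hξ.mono (ℱ.mono bot_le) le_rfl)).indicator (ℱ.mono bot_le _ hB)

theorem memLp_coefficient [IsProbabilityMeasure μ] (hst : s ≤ t) (hB : MeasurableSet[ℱ 0] B)
    (hξ : Measurable[ℱ 0] ξ) {K : ℝ} (hK : ∀ ω, |ξ ω| ≤ K) (k : ℕ) :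
    MemLp (B.indicator (V.valueOn (V.partition s t k) (V.partition s t (k + 1)) - ξ)) 2 μ := by
  obtain ⟨C, hC⟩ := V.exists_abs_valueOn_le
  refine MemLp.of_bound ((measurable_coefficient hst hB hξ k).mono (ℱ.le _)
    le_rfl).aestronglyMeasurable (C + K) (ae_of_all _ fun ω => ?_)
  refine (norm_indicator_le_norm_self _ ω).trans ?_
  rw [Pi.sub_apply]
  exact (norm_sub_le _ _).trans (add_le_add (hC _ _ ω) (hK ω))

theorem measurable_indicator_integral_sub (hW : IsBrownianRelativeTo ℱ W μ) (hst : s ≤ t)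
    (hB : MeasurableSet[ℱ 0] B) :
    Measurable[ℱ t] (B.indicator (fun ω => V.integral W t ω - V.integral W s ω)) := by
  rw [indicator_integral_sub_eq' hst]
  have := hW.measurable_discreteIntegral (monotone_partition hst)
    (measurable_coefficient (V := V) hst hB (@measurable_const _ _ _ (ℱ 0) 0)) (V.n + 2)
  rwa [partition_end] at this

variable [IsProbabilityMeasure μ]

theorem memLp_indicator_integral_sub (hW : IsBrownianRelativeTo ℱ W μ) (hst : s ≤ t)
    (hB : MeasurableSet[ℱ 0] B) (hξ : Measurable[ℱ 0] ξ) {K : ℝ} (hK : ∀ ω, |ξ ω| ≤ K) :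
    MemLp (B.indicator
      (fun ω => V.integral W t ω - V.integral W s ω - ξ ω * (W t ω - W s ω))) 2 μ := by
  rw [indicator_integral_sub_eq hst]
  exact hW.memLp_discreteIntegral (monotone_partition hst) (measurable_coefficient hst hB hξ)
    (memLp_coefficient hst hB hξ hK) _

theorem integral_mul_indicator_integral_sub (hW : IsBrownianRelativeTo ℱ W μ) (hst : s ≤ t)
    (hB : MeasurableSet[ℱ 0] B) {ζ : Ω → ℝ} (hζ : Measurable[ℱ s] ζ) (hζ2 : MemLp ζ 2 μ) :
    ∫ ω, ζ ω * B.indicator (fun ω => V.integral W t ω - V.integral W s ω) ω ∂μ = 0 := by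
  rw [indicator_integral_sub_eq' hst]
  exact hW.integral_mul_discreteIntegral (monotone_partition hst)
    (measurable_coefficient hst hB (@measurable_const _ _ _ (ℱ 0) 0))
    (memLp_coefficient hst hB (@measurable_const _ _ _ (ℱ 0) 0) (K := 0) (by simp)) hζ hζ2 _

/-- The Itô isometry for a localized and recentered elementary integral, with the integrand
compared to a process close to the recentering. -/
theorem integral_indicator_integral_sub_sq_le (hW : IsBrownianRelativeTo ℱ W μ) (hst : s ≤ t)
    (hB : MeasurableSet[ℱ 0] B) (hξ : Measurable[ℱ 0] ξ) {K : ℝ} (hK : ∀ ω, |ξ ω| ≤ K)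
    {H : unitInterval → Ω → ℝ} {C : ℝ}
    (hH : ∀ᵐ ω ∂μ, ω ∈ B → ∀ u ∈ Set.Ioc s t, |H u ω - ξ ω| ≤ C) :
    ENNReal.ofReal (∫ ω, B.indicator (fun ω => V.integral W t ω - V.integral W s ω
        - ξ ω * (W t ω - W s ω)) ω ^ 2 ∂μ) ≤
      2 * (∫⁻ p : Ω × unitInterval, ‖V.eval p.2 p.1 - H p.2 p.1‖ₑ ^ 2 ∂(μ.prod volume)) +
        ENNReal.ofReal (2 * C ^ 2 * ((t : ℝ) - s)) := by
  set σ := V.partition s t with hσdef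
  have hσ : Monotone σ := monotone_partition hst
  set η := fun k => B.indicator (V.valueOn (σ k) (σ (k + 1)) - ξ) with hηdef
  have hη : ∀ k, Measurable[ℱ (σ k)] (η k) := measurable_coefficient hst hB hξ
  have hη2 : ∀ k, MemLp (η k) 2 μ := memLp_coefficient hst hB hξ hK
  have hηm : ∀ k, Measurable fun ω => ENNReal.ofReal (η k ω ^ 2) := fun k =>
    (((hη k).mono (ℱ.le _) le_rfl).pow_const 2).ennreal_ofReal
  rw [indicator_integral_sub_eq hst]
  change ENNReal.ofReal (∫ ω, discreteIntegral W σ η (V.n + 2) ω ^ 2 ∂μ) ≤ _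
  rw [hW.integral_discreteIntegral_sq hσ hη hη2, ENNReal.ofReal_sum_of_nonneg fun k _ =>
    mul_nonneg (integral_nonneg fun ω => sq_nonneg _) (sub_nonneg.2 (hσ (Nat.le_succ k)))]
  -- Each summand becomes an integral over `Ω × [0, 1]`, which reduces the claim to a pointwise
  -- comparison of integrands.
  have hterm : ∀ k, ENNReal.ofReal ((∫ ω, η k ω ^ 2 ∂μ) * ((σ (k + 1) : ℝ) - σ k)) =
      ∫⁻ p : Ω × unitInterval, ENNReal.ofReal (η k p.1 ^ 2) *
        (Set.Ioc (σ k) (σ (k + 1))).indicator 1 p.2 ∂(μ.prod volume) := fun k => by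
    rw [lintegral_prod_mul (f := fun ω => ENNReal.ofReal (η k ω ^ 2)) (hηm k).aemeasurable
      (measurable_one.indicator measurableSet_Ioc).aemeasurable,
      lintegral_indicator_one measurableSet_Ioc, unitInterval.volume_Ioc,
      ENNReal.ofReal_mul (integral_nonneg fun ω => sq_nonneg _),
      ofReal_integral_eq_lintegral_ofReal (hη2 k).integrable_sq (ae_of_all _ fun ω => sq_nonneg _)]
  have hone : Measurable fun p : Ω × unitInterval =>
      (Set.Ioc s t).indicator (1 : unitInterval → ℝ≥0∞) p.2 :=
    (measurable_one.indicator measurableSet_Ioc).comp measurable_snd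
  have hconst : ENNReal.ofReal (2 * C ^ 2 * ((t : ℝ) - s)) =
      ∫⁻ p : Ω × unitInterval, ENNReal.ofReal (2 * C ^ 2) * (Set.Ioc s t).indicator 1 p.2
        ∂(μ.prod volume) := by
    rw [lintegral_prod_mul (f := fun _ => ENNReal.ofReal (2 * C ^ 2)) aemeasurable_const
      (measurable_one.indicator measurableSet_Ioc).aemeasurable,
      lintegral_indicator_one measurableSet_Ioc, unitInterval.volume_Ioc, lintegral_const,
      measure_univ, mul_one, ENNReal.ofReal_mul (by positivity)]
  -- These forms of linearity require no measurability of `H`.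
  rw [hconst, ← lintegral_const_mul' _ _ (by simp), ← lintegral_add_right _ (hone.const_mul _)]
  simp_rw [hterm]
  have hprod : ∀ k ∈ Finset.range (V.n + 2), Measurable fun p : Ω × unitInterval =>
      ENNReal.ofReal (η k p.1 ^ 2) * (Set.Ioc (σ k) (σ (k + 1))).indicator 1 p.2 := fun k _ =>
    ((hηm k).comp measurable_fst).mul
      ((measurable_one.indicator measurableSet_Ioc).comp measurable_snd)
  rw [← lintegral_finsetSum _ hprod]
  refine lintegral_mono_ae ?_
  filter_upwards [(Measure.quasiMeasurePreserving_fst (μ := μ) (ν := volume)).ae hH]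
    with ⟨ω, u⟩ hp
  simp only at hp ⊢
  have hle : ∀ k, ENNReal.ofReal (η k ω ^ 2) * (Set.Ioc (σ k) (σ (k + 1))).indicator 1 u ≤
      (Set.Ioc (σ k) (σ (k + 1))).indicator
        (fun _ => 2 * ‖V.eval u ω - H u ω‖ₑ ^ 2 + ENNReal.ofReal (2 * C ^ 2)) u := fun k => by
    by_cases hu : u ∈ Set.Ioc (σ k) (σ (k + 1))
    · rw [Set.indicator_of_mem hu, Set.indicator_of_mem hu, Pi.one_apply, mul_one]
      have hsq : ‖V.eval u ω - H u ω‖ₑ ^ 2 = ENNReal.ofReal ((V.eval u ω - H u ω) ^ 2) := by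
        rw [Real.enorm_eq_ofReal_abs, ← ENNReal.ofReal_pow (abs_nonneg _), sq_abs]
      have h2 : (2 : ℝ≥0∞) = ENNReal.ofReal 2 := by simp
      rw [hsq, h2, ← ENNReal.ofReal_mul (by norm_num),
        ← ENNReal.ofReal_add (by positivity) (by positivity)]
      refine ENNReal.ofReal_le_ofReal ?_
      by_cases hBω : ω ∈ B
      · have hust : u ∈ Set.Ioc s t :=
          ⟨(le_partition hst k).trans_lt hu.1, hu.2.trans (partition_le hst _)⟩
        have hHu := abs_le.1 (hp hBω u hust)
        simp only [hηdef, Set.indicator_of_mem hBω, Pi.sub_apply]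
        rw [← (noNodeBetween_partition hst k).eval_eq hu ω]
        -- This is `(x + y)² ≤ 2x² + 2y²` with `x = V - H` and `y = H - ξ`, where `|y| ≤ C` on `B`.
        nlinarith [sq_nonneg ((V.eval u ω - H u ω) - (H u ω - ξ ω)), hHu.1, hHu.2]
      · simp only [hηdef, Set.indicator_of_notMem hBω]
        rw [zero_pow two_ne_zero]
        positivity
    · simp [hu]
  refine (Finset.sum_le_sum fun k _ => hle k).trans ?_
  rw [sum_indicator_Ioc hσ, hσdef, partition_end]
  change (Set.Ioc s t).indicator _ u ≤ _
  by_cases hu : u ∈ Set.Ioc s t <;> simp [hu]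

end SimpleIntegrand

end

/-! ### Passage from elementary integrals to Itô integrals. -/

section

variable {Ω : Type*} {mΩ : MeasurableSpace Ω} {μ : Measure Ω} {W : unitInterval → Ω → ℝ}
  {ℱ : Filtration unitInterval mΩ}

theorem eLpNorm_two_sq_eq_ofReal_integral {f : Ω → ℝ} (hf : MemLp f 2 μ) :
    eLpNorm f 2 μ ^ 2 = ENNReal.ofReal (∫ ω, f ω ^ 2 ∂μ) := by
  have h := eLpNorm_nnreal_pow_eq_lintegral (μ := μ) (f := f) (p := 2) two_ne_zero
  have hsq : ∀ ω, ‖f ω‖ₑ ^ 2 = ENNReal.ofReal (f ω ^ 2) := fun ω => by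
    rw [Real.enorm_eq_ofReal_abs, ← ENNReal.ofReal_pow (abs_nonneg _), sq_abs]
  rw [ofReal_integral_eq_lintegral_ofReal hf.integrable_sq (ae_of_all _ fun ω => sq_nonneg _)]
  simp_rw [← hsq]
  simpa only [NNReal.coe_ofNat, ENNReal.coe_ofNat, ENNReal.rpow_ofNat] using h

theorem SimpleIntegrand.measurable_integral (V : SimpleIntegrand ℱ) (hW : ∀ t, Measurable (W t))
    (t : unitInterval) : Measurable (V.integral W t) := by
  unfold SimpleIntegrand.integral
  exact Finset.measurable_fun_sum _ fun i _ =>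
    ((V.adapted i).mono (ℱ.le _) le_rfl).mul ((hW _).sub (hW _))

variable [IsProbabilityMeasure μ] {H Z : unitInterval → Ω → ℝ} {B : Set Ω} {ξ : Ω → ℝ}

/-- `L²` bound for the localized increment of an Itô integral whose integrand is close to `ξ`. -/
theorem IsItoIntegral.eLpNorm_indicator_sub_le (hZ : IsItoIntegral ℱ μ H W Z)
    (hW : IsBrownianRelativeTo ℱ W μ) {s t : unitInterval} (hst : s ≤ t)
    (hB : MeasurableSet[ℱ 0] B) (hξ : Measurable[ℱ 0] ξ) {K : ℝ} (hK : ∀ ω, |ξ ω| ≤ K)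
    {C : ℝ} (hH : ∀ᵐ ω ∂μ, ω ∈ B → ∀ u ∈ Set.Ioc s t, |H u ω - ξ ω| ≤ C) :
    eLpNorm (B.indicator (fun ω => Z t ω - Z s ω - ξ ω * (W t ω - W s ω))) 2 μ ≤
      ENNReal.ofReal (2 * C ^ 2 * ((t : ℝ) - s)) ^ (1 / 2 : ℝ) := by
  obtain ⟨hZ2, V, hVH, hVZ⟩ := hZ
  have hB' : MeasurableSet B := ℱ.le 0 B hB
  set δ := fun n => ∫⁻ p : Ω × unitInterval,
    ‖(V n).eval p.2 p.1 - H p.2 p.1‖ₑ ^ 2 ∂(μ.prod volume)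
  set κ := ENNReal.ofReal (2 * C ^ 2 * ((t : ℝ) - s))
  have hlim : Tendsto (fun n => (2 * δ n + κ) ^ (1 / 2 : ℝ) +
      (eLpNorm (fun ω => (V n).integral W t ω - Z t ω) 2 μ +
        eLpNorm (fun ω => (V n).integral W s ω - Z s ω) 2 μ)) atTop (𝓝 (κ ^ (1 / 2 : ℝ))) := by
    have h1 : Tendsto (fun n => 2 * δ n + κ) atTop (𝓝 (2 * 0 + κ)) :=
      (ENNReal.Tendsto.const_mul hVH (Or.inr (by simp))).add tendsto_const_nhds
    have h2 := (ENNReal.continuous_rpow_const (y := 1 / 2)).tendsto _ |>.comp h1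
    simpa using h2.add ((hVZ t).add (hVZ s))
  refine ge_of_tendsto' hlim fun n => ?_
  set f := B.indicator (fun ω => (V n).integral W t ω - (V n).integral W s ω
    - ξ ω * (W t ω - W s ω)) with hf
  have hf2 : MemLp f 2 μ := SimpleIntegrand.memLp_indicator_integral_sub hW hst hB hξ hK
  have hfle : eLpNorm f 2 μ ≤ (2 * δ n + κ) ^ (1 / 2 : ℝ) := by
    have h := SimpleIntegrand.integral_indicator_integral_sub_sq_le (V := V n) hW hst hB hξ hK hH
    rw [← eLpNorm_two_sq_eq_ofReal_integral hf2] at h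
    have h' := ENNReal.rpow_le_rpow h (show (0 : ℝ) ≤ 1 / 2 by norm_num)
    rwa [← ENNReal.rpow_natCast, ← ENNReal.rpow_mul, Nat.cast_ofNat, mul_one_div_cancel two_ne_zero,
      ENNReal.rpow_one] at h'
  have hI (r) : AEStronglyMeasurable (fun ω => (V n).integral W r ω - Z r ω) μ :=
    ((V n).measurable_integral hW.measurable r).aestronglyMeasurable.sub
      (hZ2 r).aestronglyMeasurable
  -- The increment of `Z` is that of the `n`-th elementary integral minus approximation errors at
  -- the two endpoints, which vanish in `L²`.
  have hdecomp : B.indicator (fun ω => Z t ω - Z s ω - ξ ω * (W t ω - W s ω)) =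
      f - B.indicator ((fun ω => (V n).integral W t ω - Z t ω) -
        fun ω => (V n).integral W s ω - Z s ω) := by
    ext ω
    by_cases hω : ω ∈ B
    · simp only [hf, Set.indicator_of_mem hω, Pi.sub_apply]
      ring
    · simp [hf, hω]
  rw [hdecomp]
  refine (eLpNorm_sub_le hf2.aestronglyMeasurable (((hI t).sub (hI s)).indicator hB')
    one_le_two).trans (add_le_add hfle ?_)
  exact (eLpNorm_indicator_le _).trans (eLpNorm_sub_le (hI t) (hI s) one_le_two)

/-- Maximal inequality for Itô integrals along a finite increasing sequence of times. -/
theorem IsItoIntegral.measure_exists_le_abs_sub_le (hZ : IsItoIntegral ℱ μ H W Z)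
    (hW : IsBrownianRelativeTo ℱ W μ) (hB : MeasurableSet[ℱ 0] B) {v : ℕ → unitInterval}
    (hv : Monotone v) (m : ℕ) {C : ℝ}
    (hH : ∀ᵐ ω ∂μ, ω ∈ B → ∀ u ∈ Set.Ioc (v 0) (v m), |H u ω| ≤ C) {r : ℝ} (hr : 0 < r) :
    ENNReal.ofReal (r ^ 2) * μ {ω | ω ∈ B ∧ ∃ k ≤ m, 2 * r ≤ |Z (v k) ω - Z (v 0) ω|} ≤
      ENNReal.ofReal (2 * C ^ 2 * ((v m : ℝ) - v 0)) := by
  obtain ⟨hZ2, V, hVH, hVZ⟩ := hZ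
  set δ := fun n => ∫⁻ p : Ω × unitInterval,
    ‖(V n).eval p.2 p.1 - H p.2 p.1‖ₑ ^ 2 ∂(μ.prod volume)
  set κ := ENNReal.ofReal (2 * C ^ 2 * ((v m : ℝ) - v 0))
  set a := fun n t => eLpNorm (fun ω => (V n).integral W t ω - Z t ω) 2 μ
  have hlim : Tendsto (fun n => (2 * δ n + κ) +
      ∑ k ∈ Finset.range (m + 1), (a n (v k) + a n (v 0)) ^ 2) atTop (𝓝 κ) := by
    have h1 : Tendsto (fun n => 2 * δ n + κ) atTop (𝓝 (2 * 0 + κ)) :=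
      (ENNReal.Tendsto.const_mul hVH (Or.inr (by simp))).add tendsto_const_nhds
    have h2 : Tendsto (fun n => ∑ k ∈ Finset.range (m + 1), (a n (v k) + a n (v 0)) ^ 2) atTop
        (𝓝 (∑ k ∈ Finset.range (m + 1), (0 + 0) ^ 2)) :=
      tendsto_finsetSum _ fun k _ => ENNReal.Tendsto.pow ((hVZ (v k)).add (hVZ (v 0)))
    simpa using h1.add h2
  refine ge_of_tendsto' hlim fun n => ?_
  set M : ℕ → Ω → ℝ := fun k => B.indicator
    (fun ω => (V n).integral W (v k) ω - (V n).integral W (v 0) ω) with hM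
  set D : ℕ → Ω → ℝ := fun k ω => ((V n).integral W (v k) ω - Z (v k) ω) -
    ((V n).integral W (v 0) ω - Z (v 0) ω) with hD
  have h0m : ∀ k, v 0 ≤ v k := fun k => hv (Nat.zero_le k)
  have hξ0 : Measurable[ℱ 0] (fun _ : Ω => (0 : ℝ)) := @measurable_const _ _ _ (ℱ 0) 0
  have hM2 : ∀ k, MemLp (M k) 2 μ := fun k => by
    simpa using SimpleIntegrand.memLp_indicator_integral_sub (V := V n) hW (h0m k) hB hξ0 (K := 0)
      (by simp)
  have hI (r) : AEStronglyMeasurable (fun ω => (V n).integral W r ω - Z r ω) μ :=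
    ((V n).measurable_integral hW.measurable r).aestronglyMeasurable.sub
      (hZ2 r).aestronglyMeasurable
  have hmax : ENNReal.ofReal (r ^ 2) * μ {ω | ∃ k ≤ m, r ≤ |M k ω|} ≤ 2 * δ n + κ := by
    let 𝒢 : Filtration ℕ mΩ := ⟨fun k => ℱ (v k), fun i j hij => ℱ.mono (hv hij), fun k => ℱ.le _⟩
    refine (measure_exists_le_abs_le (𝒢 := 𝒢) (fun k =>
      SimpleIntegrand.measurable_indicator_integral_sub hW (h0m k) hB) hM2
      (fun k ζ hζ hζ2 => ?_) hr m).trans ?_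
    · have h := SimpleIntegrand.integral_mul_indicator_integral_sub (V := V n) hW
        (hv (Nat.le_succ k)) hB hζ hζ2
      rw [← h]
      refine integral_congr_ae (ae_of_all _ fun ω => ?_)
      by_cases hω : ω ∈ B <;> simp [hω]
    · simpa using SimpleIntegrand.integral_indicator_integral_sub_sq_le (V := V n) hW (h0m m) hB
        hξ0 (K := 0) (by simp) (H := H) (by simpa using hH)
  have hDm : ∀ k, ENNReal.ofReal (r ^ 2) * μ {ω | r ≤ |D k ω|} ≤ (a n (v k) + a n (v 0)) ^ 2 :=
    fun k => by
      have h := mul_meas_ge_le_pow_eLpNorm' μ two_ne_zero ENNReal.ofNat_ne_top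
        ((hI (v k)).sub (hI (v 0))) (ENNReal.ofReal r)
      have hset : {ω | r ≤ |D k ω|} = {ω | ENNReal.ofReal r ≤ ‖((fun ω =>
          (V n).integral W (v k) ω - Z (v k) ω) - fun ω =>
            (V n).integral W (v 0) ω - Z (v 0) ω) ω‖ₑ} := by
        ext ω
        rw [Set.mem_ofPred_eq, Set.mem_ofPred_eq, Real.enorm_eq_ofReal_abs,
          ENNReal.ofReal_le_ofReal_iff (abs_nonneg _)]
        rfl
      rw [hset, ENNReal.ofReal_pow hr.le]
      simp only [ENNReal.toReal_ofNat, ENNReal.rpow_ofNat] at h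
      refine h.trans (pow_le_pow_left' ?_ 2)
      exact eLpNorm_sub_le (hI _) (hI _) one_le_two
  -- The threshold `2 * r` is split in two: either the elementary martingale `M` reaches `r`, or one
  -- of the finitely many errors `D k` does.
  have hsub : {ω | ω ∈ B ∧ ∃ k ≤ m, 2 * r ≤ |Z (v k) ω - Z (v 0) ω|} ⊆
      {ω | ∃ k ≤ m, r ≤ |M k ω|} ∪ ⋃ k ∈ Finset.range (m + 1), {ω | r ≤ |D k ω|} := by
    rintro ω ⟨hω, k, hk, hle⟩
    by_cases hMk : r ≤ |M k ω|
    · exact Or.inl ⟨k, hk, hMk⟩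
    · refine Or.inr (Set.mem_biUnion (Finset.mem_range.2 (Nat.lt_succ_of_le hk)) ?_)
      simp only [hM, Set.indicator_of_mem hω, not_le] at hMk
      have heq : Z (v k) ω - Z (v 0) ω =
          ((V n).integral W (v k) ω - (V n).integral W (v 0) ω) - D k ω := by
        simp only [hD]; ring
      have := abs_sub ((V n).integral W (v k) ω - (V n).integral W (v 0) ω) (D k ω)
      rw [← heq] at this
      simp only [Set.mem_ofPred_eq]
      linarith
  calc _ ≤ ENNReal.ofReal (r ^ 2) * (μ {ω | ∃ k ≤ m, r ≤ |M k ω|} +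
        ∑ k ∈ Finset.range (m + 1), μ {ω | r ≤ |D k ω|}) := by
        gcongr
        exact (measure_mono hsub).trans ((measure_union_le _ _).trans
          (add_le_add le_rfl (measure_biUnion_finset_le _ _)))
    _ ≤ _ := by
        rw [mul_add, Finset.mul_sum]
        exact add_le_add hmax (Finset.sum_le_sum fun k _ => hDm k)

end

/-! ### Continuous-time maximal inequality and the lower bound for the exponent. -/

section

/-- The `k`-th point of the dyadic partition of `[s, t]` of level `m`. -/
def dyadicPoint (s t : unitInterval) (m k : ℕ) : unitInterval :=
  Set.projIcc 0 1 zero_le_one ((s : ℝ) + ((t : ℝ) - s) * min ((k : ℝ) / 2 ^ m) 1)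

theorem monotone_dyadicPoint {s t : unitInterval} (hst : s ≤ t) (m : ℕ) :
    Monotone (dyadicPoint s t m) := by
  intro i j hij
  have : (0 : ℝ) ≤ (t : ℝ) - s := sub_nonneg.2 hst
  refine Set.monotone_projIcc _ (add_le_add le_rfl (mul_le_mul_of_nonneg_left ?_ this))
  gcongr

theorem dyadicPoint_zero (s t : unitInterval) (m : ℕ) : dyadicPoint s t m 0 = s := by
  simp [dyadicPoint]

theorem dyadicPoint_last (s t : unitInterval) (m : ℕ) : dyadicPoint s t m (2 ^ m) = t := by
  simp [dyadicPoint]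

theorem dyadicPoint_succ (s t : unitInterval) (m k : ℕ) :
    dyadicPoint s t (m + 1) (2 * k) = dyadicPoint s t m k := by
  have : ((2 * k : ℕ) : ℝ) / 2 ^ (m + 1) = (k : ℝ) / 2 ^ m := by
    push_cast; field_simp; ring
  rw [dyadicPoint, dyadicPoint, this]

theorem exists_tendsto_dyadicPoint {s t u : unitInterval} (hu : u ∈ Set.Icc s t) :
    ∃ κ : ℕ → ℕ, (∀ m, κ m ≤ 2 ^ m) ∧
      Tendsto (fun m => dyadicPoint s t m (κ m)) atTop (𝓝 u) := by
  have h1 : (s : ℝ) ≤ u := hu.1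
  have h2 : (u : ℝ) ≤ t := hu.2
  set θ : ℝ := ((u : ℝ) - s) / ((t : ℝ) - s) with hθ
  have hθ0 : 0 ≤ θ := div_nonneg (by linarith) (by linarith)
  have hθ1 : θ ≤ 1 := div_le_one_of_le₀ (by linarith) (by linarith)
  -- If `s = t`, division by zero gives `θ = 0`, and the identity still holds because `u = s`.
  have hmul : (s : ℝ) + ((t : ℝ) - s) * θ = u := by
    rcases eq_or_ne ((t : ℝ) - s) 0 with h0 | h0
    · rw [h0]; linarith
    · rw [hθ, mul_div_cancel₀ _ h0]; ring
  refine ⟨fun m => ⌊θ * 2 ^ m⌋₊, fun m => ?_, ?_⟩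
  · refine Nat.floor_le_of_le ?_
    push_cast
    exact mul_le_of_le_one_left (by positivity) hθ1
  · have hlim : Tendsto (fun m : ℕ => (⌊θ * 2 ^ m⌋₊ : ℝ) / 2 ^ m) atTop (𝓝 θ) :=
      (tendsto_nat_floor_mul_div_atTop hθ0).comp
        (tendsto_pow_atTop_atTop_of_one_lt (one_lt_two : (1 : ℝ) < 2))
    have h3 : Tendsto (fun m : ℕ => (s : ℝ) + ((t : ℝ) - s) *
        min ((⌊θ * 2 ^ m⌋₊ : ℝ) / 2 ^ m) 1) atTop (𝓝 ((s : ℝ) + ((t : ℝ) - s) * min θ 1)) :=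
      (((hlim.min tendsto_const_nhds).const_mul _).const_add _)
    rw [min_eq_left hθ1, hmul] at h3
    have h4 := (continuous_projIcc (h := zero_le_one (α := ℝ))).continuousAt.tendsto.comp h3
    simpa [dyadicPoint, Function.comp_def] using h4

variable {Ω : Type*} {mΩ : MeasurableSpace Ω} {μ : Measure Ω} {W : unitInterval → Ω → ℝ}
  {ℱ : Filtration unitInterval mΩ} [IsProbabilityMeasure μ] {H Z : unitInterval → Ω → ℝ}
  {B : Set Ω}

/-- Maximal inequality for a continuous version of an Itô integral on `[s, t]`. -/
theorem IsItoIntegral.measure_exists_mem_Icc_lt_abs_sub_le (hZ : IsItoIntegral ℱ μ H W Z)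
    (hW : IsBrownianRelativeTo ℱ W μ) (hZcont : ∀ᵐ ω ∂μ, Continuous fun t => Z t ω)
    (hB : MeasurableSet[ℱ 0] B) {s t : unitInterval} (hst : s ≤ t) {C : ℝ}
    (hH : ∀ᵐ ω ∂μ, ω ∈ B → ∀ u ∈ Set.Ioc s t, |H u ω| ≤ C) {r : ℝ} (hr : 0 < r) :
    μ {ω | ω ∈ B ∧ ∃ u ∈ Set.Icc s t, 2 * r < |Z u ω - Z s ω|} ≤
      ENNReal.ofReal (2 * C ^ 2 * ((t : ℝ) - s) / r ^ 2) := by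
  set E : ℕ → Set Ω := fun m => {ω | ω ∈ B ∧ ∃ k ≤ 2 ^ m,
    2 * r ≤ |Z (dyadicPoint s t m k) ω - Z s ω|} with hE
  have hEmono : Monotone E := by
    refine monotone_nat_of_le_succ fun m => ?_
    rintro ω ⟨hω, k, hk, hle⟩
    refine ⟨hω, 2 * k, ?_, ?_⟩
    · rw [pow_succ']; omega
    · rwa [dyadicPoint_succ]
  have hEle : ∀ m, μ (E m) ≤ ENNReal.ofReal (2 * C ^ 2 * ((t : ℝ) - s) / r ^ 2) := fun m => by
    have h := hZ.measure_exists_le_abs_sub_le hW hB (monotone_dyadicPoint hst m) (2 ^ m) (C := C)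
      (by rwa [dyadicPoint_zero, dyadicPoint_last]) hr
    rw [dyadicPoint_zero, dyadicPoint_last] at h
    rw [ENNReal.ofReal_div_of_pos (by positivity), ENNReal.le_div_iff_mul_le
      (Or.inl (ENNReal.ofReal_pos.2 (pow_pos hr 2)).ne') (Or.inl ENNReal.ofReal_ne_top), mul_comm]
    exact h
  -- The strict inequality is an open condition on the continuous path, so it persists at a nearby
  -- dyadic point.
  have hsub : ∀ᵐ ω ∂μ, ω ∈ {ω | ω ∈ B ∧ ∃ u ∈ Set.Icc s t, 2 * r < |Z u ω - Z s ω|} →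
      ω ∈ ⋃ m, E m := by
    filter_upwards [hZcont] with ω hc
    rintro ⟨hω, u, hu, hlt⟩
    obtain ⟨κ, hκ, hlim⟩ := exists_tendsto_dyadicPoint hu
    have hZlim : Tendsto (fun m => |Z (dyadicPoint s t m (κ m)) ω - Z s ω|) atTop
        (𝓝 |Z u ω - Z s ω|) :=
      (((hc.tendsto u).comp hlim).sub tendsto_const_nhds).abs
    obtain ⟨m, hm⟩ := (hZlim.eventually (lt_mem_nhds hlt)).exists
    exact Set.mem_iUnion.2 ⟨m, hω, κ m, hκ m, hm.le⟩
  have hle : μ {ω | ω ∈ B ∧ ∃ u ∈ Set.Icc s t, 2 * r < |Z u ω - Z s ω|} ≤ μ (⋃ m, E m) :=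
    measure_mono_ae hsub
  refine hle.trans ?_
  rw [hEmono.measure_iUnion]
  exact iSup_le hEle

/-- Around any point, a continuous Itô integral with bounded integrand has local modulus of
continuity `h ^ ρ` for every `ρ < 1 / 2`. -/
theorem IsItoIntegral.ae_eventually_abs_sub_le (hZ : IsItoIntegral ℱ μ H W Z)
    (hW : IsBrownianRelativeTo ℱ W μ) (hZcont : ∀ᵐ ω ∂μ, Continuous fun t => Z t ω)
    (hB : MeasurableSet[ℱ 0] B) {C : ℝ} (hH : ∀ᵐ ω ∂μ, ω ∈ B → ∀ u, |H u ω| ≤ C)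
    (t₀ : unitInterval) {ρ : ℝ} (hρ : ρ < 1 / 2) :
    ∀ᵐ ω ∂μ, ω ∈ B → ∀ᶠ n : ℕ in atTop, ∀ u : unitInterval,
      |(u : ℝ) - t₀| ≤ (1 / 2) ^ n → |Z u ω - Z t₀ ω| ≤ 4 * ((1 / 2 : ℝ) ^ n) ^ ρ := by
  set a : ℕ → unitInterval := fun n => Set.projIcc 0 1 zero_le_one ((t₀ : ℝ) - (1 / 2) ^ n)
  set b : ℕ → unitInterval := fun n => Set.projIcc 0 1 zero_le_one ((t₀ : ℝ) + (1 / 2) ^ n)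
  have hmem : ∀ n (u : unitInterval), |(u : ℝ) - t₀| ≤ (1 / 2) ^ n → u ∈ Set.Icc (a n) (b n) := by
    intro n u hu
    rw [abs_le] at hu
    have hu' : Set.projIcc 0 1 zero_le_one (u : ℝ) = u := Set.projIcc_val zero_le_one u
    rw [← hu']
    exact ⟨Set.monotone_projIcc _ (by linarith), Set.monotone_projIcc _ (by linarith)⟩
  have hlen : ∀ n, ((b n : ℝ) - a n) ≤ 2 * (1 / 2) ^ n := fun n => by
    have h1 : (b n : ℝ) ≤ (t₀ : ℝ) + (1 / 2) ^ n := by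
      simp only [b, Set.coe_projIcc]
      have := t₀.2.1
      exact max_le (by positivity) (min_le_right _ _)
    have h2 : (t₀ : ℝ) - (1 / 2) ^ n ≤ a n := by
      simp only [a, Set.coe_projIcc]
      refine le_max_of_le_right (le_min ?_ le_rfl)
      have := t₀.2.2
      have : (0 : ℝ) < (1 / 2) ^ n := by positivity
      linarith
    linarith
  have ht₀ : ∀ n, t₀ ∈ Set.Icc (a n) (b n) := fun n => hmem n t₀ (by simp)
  set r : ℕ → ℝ := fun n => ((1 / 2 : ℝ) ^ n) ^ ρ
  have hr : ∀ n, 0 < r n := fun n => by positivity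
  -- The maximal inequality at level `r n` costs a multiple of `2⁻ⁿ / r n ^ 2 = q ^ n`; here `ρ < 1
  -- / 2` gives `q < 1`, hence the summability for Borel–Cantelli.
  set q : ℝ := (1 / 2 : ℝ) ^ (1 - 2 * ρ)
  have hq : q < 1 := Real.rpow_lt_one (by norm_num) (by norm_num) (by linarith)
  have hq0 : 0 < q := by positivity
  have hqr : ∀ n, (1 / 2 : ℝ) ^ n / r n ^ 2 = q ^ n := fun n => by
    have hp : (0 : ℝ) < 1 / 2 := by norm_num
    simp only [q, r]
    rw [← Real.rpow_natCast, ← Real.rpow_natCast, ← Real.rpow_mul hp.le, ← Real.rpow_mul hp.le,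
      ← Real.rpow_sub hp, ← Real.rpow_natCast, ← Real.rpow_mul hp.le]
    congr 1
    push_cast
    ring
  set bad : ℕ → Set Ω := fun n =>
    {ω | ω ∈ B ∧ ∃ u ∈ Set.Icc (a n) (b n), 2 * r n < |Z u ω - Z (a n) ω|}
  have hbad : ∀ n, μ (bad n) ≤ ENNReal.ofReal (4 * C ^ 2 * q ^ n) := fun n => by
    refine (hZ.measure_exists_mem_Icc_lt_abs_sub_le hW hZcont hB ((ht₀ n).1.trans (ht₀ n).2)
      (C := C) ?_ (hr n)).trans (ENNReal.ofReal_le_ofReal ?_)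
    · filter_upwards [hH] with ω h hω u _ using h hω u
    · rw [← hqr, mul_div_assoc', div_le_div_iff_of_pos_right (pow_pos (hr n) 2)]
      nlinarith [hlen n, sq_nonneg C]
  have hsum : ∑' n, μ (bad n) ≠ ∞ := by
    refine ne_top_of_le_ne_top ?_ (ENNReal.tsum_le_tsum hbad)
    rw [← ENNReal.ofReal_tsum_of_nonneg (fun n => by positivity)
      ((summable_geometric_of_lt_one hq0.le hq).mul_left _)]
    exact ENNReal.ofReal_ne_top
  filter_upwards [ae_eventually_notMem hsum] with ω hω hωB
  filter_upwards [hω] with n hn u hu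
  -- Both `u` and `t₀` are compared with the left endpoint `a n`, whence the constant `4`.
  have hle : ∀ v ∈ Set.Icc (a n) (b n), |Z v ω - Z (a n) ω| ≤ 2 * r n := fun v hv => by
    by_contra! hcon
    exact hn ⟨hωB, v, hv, hcon⟩
  have h1 := hle u (hmem n u hu)
  have h2 := hle t₀ (ht₀ n)
  have h3 := abs_sub_le (Z u ω) (Z (a n) ω) (Z t₀ ω)
  rw [abs_sub_comm (Z (a n) ω)] at h3
  change _ ≤ 4 * r n
  linarith

/-- A dyadic local modulus of continuity gives decay of the Hölder quotients of lower order. -/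
theorem tendsto_holder_quotient {y : unitInterval → ℝ} {t₀ : unitInterval} {ρ ρ' K : ℝ}
    (hρ' : 0 ≤ ρ') (hlt : ρ < ρ')
    (h : ∀ᶠ n : ℕ in atTop, ∀ u : unitInterval,
      |(u : ℝ) - t₀| ≤ (1 / 2) ^ n → |y u - y t₀| ≤ K * ((1 / 2 : ℝ) ^ n) ^ ρ') :
    Tendsto (fun u : unitInterval => |y u - y t₀| / |(u : ℝ) - t₀| ^ ρ) (𝓝[≠] t₀) (𝓝 0) := by
  obtain ⟨N, hN⟩ := eventually_atTop.1 h
  have hK : 0 ≤ K := by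
    have := (abs_nonneg _).trans (hN N le_rfl t₀ (by simp))
    exact nonneg_of_mul_nonneg_left this (by positivity)
  have hd : Tendsto (fun u : unitInterval => |(u : ℝ) - t₀|) (𝓝[≠] t₀) (𝓝 0) := by
    have : Continuous fun u : unitInterval => |(u : ℝ) - t₀| := by fun_prop
    simpa using (this.tendsto t₀).mono_left nhdsWithin_le_nhds
  have hlim : Tendsto (fun u : unitInterval => K * 2 ^ ρ' * |(u : ℝ) - t₀| ^ (ρ' - ρ))
      (𝓝[≠] t₀) (𝓝 0) := by
    have := (hd.rpow_const (p := ρ' - ρ) (Or.inr (by linarith))).const_mul (K * 2 ^ ρ')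
    rwa [Real.zero_rpow (by linarith), mul_zero] at this
  refine squeeze_zero' (Eventually.of_forall fun u => by positivity) ?_ hlim
  filter_upwards [self_mem_nhdsWithin, hd.eventually (gt_mem_nhds (show (0 : ℝ) < (1 / 2) ^ N by
    positivity))] with u hu hux
  set x := |(u : ℝ) - t₀| with hx
  have hx0 : 0 < x := abs_pos.2 (sub_ne_zero.2 fun h => hu (Subtype.ext h))
  have hx1 : x ≤ 1 := hux.le.trans (pow_le_one₀ (by norm_num) (by norm_num))
  -- The dyadic scale satisfies `2⁻ⁿ⁻¹ < x ≤ 2⁻ⁿ`; replacing `2⁻ⁿ` by `2 * x` costs the factor `2 ^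
  -- ρ'`.
  obtain ⟨n, hn1, hn2⟩ := exists_nat_pow_near_of_lt_one hx0 hx1 (by norm_num : (0 : ℝ) < 1 / 2)
    (by norm_num)
  have hnN : N ≤ n := by
    by_contra! hcon
    have : (1 / 2 : ℝ) ^ N ≤ (1 / 2) ^ (n + 1) :=
      pow_le_pow_of_le_one (by norm_num) (by norm_num) hcon
    linarith
  have h1 := hN n hnN u hn2
  have h2 : ((1 / 2 : ℝ) ^ n) ^ ρ' ≤ 2 ^ ρ' * x ^ ρ' := by
    rw [← Real.mul_rpow (by norm_num) hx0.le]
    refine Real.rpow_le_rpow (by positivity) ?_ hρ'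
    rw [pow_succ] at hn1
    linarith
  rw [div_le_iff₀ (by positivity), mul_assoc, ← Real.rpow_add hx0, sub_add_cancel, mul_assoc]
  exact h1.trans (mul_le_mul_of_nonneg_left h2 hK)

/-- The Hölder exponent of an Itô integral with bounded integrand is at least `1 / 2`. -/
theorem IsItoIntegral.ae_tendsto_holder_quotient (hZ : IsItoIntegral ℱ μ H W Z)
    (hW : IsBrownianRelativeTo ℱ W μ) (hZcont : ∀ᵐ ω ∂μ, Continuous fun t => Z t ω)
    (hB : MeasurableSet[ℱ 0] B) {C : ℝ} (hH : ∀ᵐ ω ∂μ, ω ∈ B → ∀ u, |H u ω| ≤ C)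
    (t₀ : unitInterval) {ρ : ℝ} (hρ0 : 0 ≤ ρ) (hρ : ρ < 1 / 2) :
    ∀ᵐ ω ∂μ, ω ∈ B → Tendsto (fun u : unitInterval =>
      |Z u ω - Z t₀ ω| / |(u : ℝ) - t₀| ^ ρ) (𝓝[≠] t₀) (𝓝 0) := by
  obtain ⟨ρ', h1, h2⟩ := exists_between hρ
  filter_upwards [hZ.ae_eventually_abs_sub_le hW hZcont hB hH t₀ h2] with ω h hω
  exact tendsto_holder_quotient (hρ0.trans h1.le) h1 (h hω)

end

/-! ### Freezing the integrand and the upper bound for the exponent. -/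

section

variable {Ω : Type*} {mΩ : MeasurableSpace Ω} {μ : Measure Ω} {W : unitInterval → Ω → ℝ}
  {ℱ : Filtration unitInterval mΩ}

/-- Identically distributed variables whose law does not charge `0` do not converge to `0`. -/
theorem ae_not_tendsto_zero_of_hasLaw {ν : Measure ℝ} [IsFiniteMeasure ν] (hν : ν {0} = 0)
    {N : ℕ → Ω → ℝ} (hN : ∀ᶠ i in atTop, HasLaw (N i) ν μ) :
    ∀ᵐ ω ∂μ, ¬ Tendsto (fun i => N i ω) atTop (𝓝 0) := by
  -- Convergence to `0` forces `|N i| < ε` for all large `i`, and each such event has probability at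
  -- most that of the ball under `ν`; joint laws play no role.
  have hball : ∀ ε : ℝ, 0 < ε → μ {ω | Tendsto (fun i => N i ω) atTop (𝓝 0)} ≤
      ν {x | |x| < ε} := fun ε hε => by
    set E : ℕ → Set Ω := fun m => {ω | ∀ i ≥ m, |N i ω| < ε}
    have hE : Monotone E := fun m n hmn ω hω i hi => hω i (hmn.trans hi)
    have hsub : {ω | Tendsto (fun i => N i ω) atTop (𝓝 0)} ⊆ ⋃ m, E m := fun ω hω => by
      have : Tendsto (fun i => |N i ω|) atTop (𝓝 0) := by
        simpa using (show Tendsto (fun i => N i ω) atTop (𝓝 0) from hω).abs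
      obtain ⟨m, hm⟩ := eventually_atTop.1 (this.eventually (gt_mem_nhds hε))
      exact Set.mem_iUnion.2 ⟨m, hm⟩
    refine (measure_mono hsub).trans ?_
    rw [hE.measure_iUnion]
    refine iSup_le fun m => ?_
    obtain ⟨i, hi, hmi⟩ := (hN.and (eventually_ge_atTop m)).exists
    have hmeas : MeasurableSet {x : ℝ | |x| < ε} :=
      measurableSet_lt continuous_abs.measurable measurable_const
    rw [← hi.measure_eq (p := fun x => |x| < ε) hmeas]
    exact measure_mono fun ω hω => hω i hmi
  have hlim := tendsto_measure_iInter_atTop (μ := ν)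
    (s := fun n : ℕ => {x : ℝ | |x| < 1 / ((n : ℝ) + 1)})
    (fun n => (measurableSet_lt continuous_abs.measurable measurable_const).nullMeasurableSet)
    (fun m n hmn x (hx : |x| < _) => lt_of_lt_of_le hx (one_div_le_one_div_of_le
      (by positivity) (by gcongr)))
    ⟨0, measure_ne_top _ _⟩
  have hinter : ⋂ n : ℕ, {x : ℝ | |x| < 1 / ((n : ℝ) + 1)} = {0} := by
    ext x
    simp only [Set.mem_iInter, Set.mem_ofPred_eq, Set.mem_singleton_iff]
    refine ⟨fun h => ?_, fun h n => by rw [h, abs_zero]; positivity⟩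
    by_contra hx
    obtain ⟨n, hn⟩ := exists_nat_one_div_lt (abs_pos.2 hx)
    exact absurd (h n) (not_lt.2 hn.le)
  rw [hinter, hν] at hlim
  rw [ae_iff]
  simp only [not_not]
  exact le_antisymm (ge_of_tendsto' hlim fun n => hball _ (by positivity)) zero_le

theorem IsBrownianRelativeTo.hasLaw_increment_div_sqrt (hW : IsBrownianRelativeTo ℱ W μ)
    {u v : unitInterval} (huv : u ≠ v) :
    HasLaw (fun ω => (W u ω - W v ω) / √|(u : ℝ) - v|) (gaussianReal 0 1) μ := by
  have hpos : 0 < |(u : ℝ) - v| := abs_pos.2 (sub_ne_zero.2 fun h => huv (Subtype.ext h))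
  have hlaw : HasLaw (fun ω => W u ω - W v ω) (gaussianReal 0 (|(u : ℝ) - v|).toNNReal) μ := by
    rcases le_total v u with h | h
    · rw [abs_of_nonneg (sub_nonneg.2 (Subtype.coe_le_coe.2 h))]
      exact hW.law v u h
    · rw [abs_of_nonpos (sub_nonpos.2 (Subtype.coe_le_coe.2 h)), neg_sub]
      have := gaussianReal_neg (hW.law u v h)
      rw [neg_zero] at this
      refine this.congr (ae_of_all _ fun ω => ?_)
      simp
  have h := gaussianReal_div_const hlaw (√|(u : ℝ) - v|)
  have hv : (|(u : ℝ) - v|).toNNReal / (.mk (√|(u : ℝ) - v| ^ 2) (sq_nonneg _)) = (1 : ℝ≥0) := by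
    ext
    simp [Real.sq_sqrt hpos.le, hpos.ne']
  rwa [hv, zero_div] at h

theorem eventually_nhdsNE_abs_sub_pos (t₀ : unitInterval) :
    ∀ᶠ u : unitInterval in 𝓝[≠] t₀, 0 < |(u : ℝ) - t₀| := by
  filter_upwards [self_mem_nhdsWithin] with u hu
  exact abs_pos.2 (sub_ne_zero.2 fun h => hu (Subtype.ext h))

theorem tendsto_abs_sub_nhdsNE (t₀ : unitInterval) :
    Tendsto (fun u : unitInterval => |(u : ℝ) - t₀|) (𝓝[≠] t₀) (𝓝 0) := by
  have : Continuous fun u : unitInterval => |(u : ℝ) - t₀| := by fun_prop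
  simpa using (this.tendsto t₀).mono_left nhdsWithin_le_nhds

variable [IsProbabilityMeasure μ] {H Z : unitInterval → Ω → ℝ} {B : Set Ω} {ξ : Ω → ℝ}

/-- Between `t₀` and `u` the integrand is within `C * |u - t₀| ^ α` of `ξ`, and the interval length
in the isometry bound is absorbed by the square root. For `u < t₀` the same bound applies because
`ξ` is `ℱ 0`-measurable. -/
theorem IsItoIntegral.eLpNorm_quotient_le (hZ : IsItoIntegral ℱ μ H W Z)
    (hW : IsBrownianRelativeTo ℱ W μ) (hB : MeasurableSet[ℱ 0] B) (hξ : Measurable[ℱ 0] ξ)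
    {K : ℝ} (hK : ∀ ω, |ξ ω| ≤ K) {t₀ : unitInterval} {C α : ℝ} (hC : 0 ≤ C) (hα : 0 < α)
    (hH : ∀ᵐ ω ∂μ, ω ∈ B → ∀ u : unitInterval, |H u ω - ξ ω| ≤ C * |(u : ℝ) - t₀| ^ α)
    {u : unitInterval} (hu : 0 < |(u : ℝ) - t₀|) :
    eLpNorm (B.indicator fun ω => (Z u ω - Z t₀ ω - ξ ω * (W u ω - W t₀ ω)) / √|(u : ℝ) - t₀|)
      2 μ ≤ ENNReal.ofReal (√2 * C * |(u : ℝ) - t₀| ^ α) := by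
  set d := |(u : ℝ) - t₀| with hd
  set R : Ω → ℝ := B.indicator fun ω => Z u ω - Z t₀ ω - ξ ω * (W u ω - W t₀ ω) with hR
  have hRle : eLpNorm R 2 μ ≤ ENNReal.ofReal (√2 * C * d ^ α * √d) := by
    have hroot : ENNReal.ofReal (√2 * C * d ^ α * √d) =
        ENNReal.ofReal (2 * (C * d ^ α) ^ 2 * d) ^ (1 / 2 : ℝ) := by
      rw [ENNReal.ofReal_rpow_of_nonneg (by positivity) (by norm_num), ← Real.sqrt_eq_rpow,
        Real.sqrt_mul (by positivity), Real.sqrt_mul (by norm_num),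
        Real.sqrt_sq (by positivity), mul_assoc (√2) C]
    rw [hroot]
    rcases le_total t₀ u with h | h
    · have hdu : d = (u : ℝ) - t₀ :=
        abs_of_nonneg (sub_nonneg.2 (Subtype.coe_le_coe.2 h))
      rw [show ENNReal.ofReal (2 * (C * d ^ α) ^ 2 * d) =
        ENNReal.ofReal (2 * (C * d ^ α) ^ 2 * ((u : ℝ) - t₀)) by rw [← hdu]]
      refine hZ.eLpNorm_indicator_sub_le hW h hB hξ hK ?_
      filter_upwards [hH] with ω hω hωB v hv
      refine (hω hωB v).trans ?_
      have h1 : (t₀ : ℝ) < v := hv.1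
      have h2 : (v : ℝ) ≤ u := hv.2
      have : |(v : ℝ) - t₀| ≤ d := by rw [hdu, abs_of_pos (by linarith)]; linarith
      gcongr
    · have hdu : d = (t₀ : ℝ) - u := by rw [hd, abs_of_nonpos (sub_nonpos.2 (Subtype.coe_le_coe.2 h)), neg_sub]
      have hneg : R = -B.indicator fun ω => Z t₀ ω - Z u ω - ξ ω * (W t₀ ω - W u ω) := by
        ext ω
        by_cases hω : ω ∈ B
        · simp only [hR, Pi.neg_apply, Set.indicator_of_mem hω]
          ring
        · simp [hR, hω]
      rw [hneg, eLpNorm_neg, show ENNReal.ofReal (2 * (C * d ^ α) ^ 2 * d) =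
        ENNReal.ofReal (2 * (C * d ^ α) ^ 2 * ((t₀ : ℝ) - u)) by rw [← hdu]]
      refine hZ.eLpNorm_indicator_sub_le hW h hB hξ hK ?_
      filter_upwards [hH] with ω hω hωB v hv
      refine (hω hωB v).trans ?_
      have h1 : (u : ℝ) < v := hv.1
      have h2 : (v : ℝ) ≤ t₀ := hv.2
      have : |(v : ℝ) - t₀| ≤ d := by rw [hdu, abs_of_nonpos (by linarith)]; linarith
      gcongr
  have hscale : (B.indicator fun ω => (Z u ω - Z t₀ ω - ξ ω * (W u ω - W t₀ ω)) / √d) =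
      (√d)⁻¹ • R := by
    ext ω
    by_cases hω : ω ∈ B
    · simp only [hR, Pi.smul_apply, Set.indicator_of_mem hω, smul_eq_mul]
      ring
    · simp [hR, hω]
  have hsd : 0 < √d := Real.sqrt_pos.2 hu
  rw [hscale, eLpNorm_const_smul, Real.enorm_eq_ofReal (by positivity)]
  calc _ ≤ ENNReal.ofReal (√d)⁻¹ * ENNReal.ofReal (√2 * C * d ^ α * √d) := by gcongr
    _ = _ := by
      rw [← ENNReal.ofReal_mul (by positivity)]
      congr 1
      field_simp

/-- At `t₀`, an Itô integral whose integrand is continuous at `t₀` with nonzero value there does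
not satisfy a little-`o` Hölder condition of order `1 / 2`. -/
theorem IsItoIntegral.ae_not_tendsto_quotient (hZ : IsItoIntegral ℱ μ H W Z)
    (hW : IsBrownianRelativeTo ℱ W μ) (hB : MeasurableSet[ℱ 0] B) (hξ : Measurable[ℱ 0] ξ)
    {K : ℝ} (hK : ∀ ω, |ξ ω| ≤ K) {t₀ : unitInterval} {C α : ℝ} (hC : 0 ≤ C) (hα : 0 < α)
    (hH : ∀ᵐ ω ∂μ, ω ∈ B → ∀ u : unitInterval, |H u ω - ξ ω| ≤ C * |(u : ℝ) - t₀| ^ α)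
    (hξ0 : ∀ᵐ ω ∂μ, ω ∈ B → ξ ω ≠ 0) :
    ∀ᵐ ω ∂μ, ω ∈ B → ¬ Tendsto (fun u : unitInterval =>
      |Z u ω - Z t₀ ω| / |(u : ℝ) - t₀| ^ (1 / 2 : ℝ)) (𝓝[≠] t₀) (𝓝 0) := by
  set f : unitInterval → Ω → ℝ := fun u => B.indicator fun ω =>
    (Z u ω - Z t₀ ω - ξ ω * (W u ω - W t₀ ω)) / √|(u : ℝ) - t₀| with hf
  have hfm : ∀ u, AEStronglyMeasurable (f u) μ := fun u => by
    have hZm := fun r => (hZ.1 r).aestronglyMeasurable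
    have hξm : AEStronglyMeasurable ξ μ := (hξ.mono (ℱ.le 0) le_rfl).aestronglyMeasurable
    have hWm := fun r => (hW.measurable r).aestronglyMeasurable (μ := μ)
    simp only [hf, div_eq_mul_inv]
    exact ((((hZm u).sub (hZm t₀)).sub (hξm.mul ((hWm u).sub (hWm t₀)))).mul_const _).indicator
      (ℱ.le 0 B hB)
  have hflim : Tendsto (fun u => eLpNorm (f u - 0) 2 μ) (𝓝[≠] t₀) (𝓝 0) := by
    have h1 : Tendsto (fun u : unitInterval => ENNReal.ofReal (√2 * C * |(u : ℝ) - t₀| ^ α))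
        (𝓝[≠] t₀) (𝓝 0) := by
      have := ((tendsto_abs_sub_nhdsNE t₀).rpow_const (p := α) (Or.inr hα.le)).const_mul (√2 * C)
      rw [Real.zero_rpow hα.ne', mul_zero] at this
      simpa using ENNReal.tendsto_ofReal this
    refine tendsto_of_tendsto_of_tendsto_of_le_of_le' tendsto_const_nhds h1
      (Eventually.of_forall fun _ => zero_le) ?_
    filter_upwards [eventually_nhdsNE_abs_sub_pos t₀] with u hu
    rw [sub_zero]
    exact hZ.eLpNorm_quotient_le hW hB hξ hK hC hα hH hu
  -- `L²` convergence gives convergence in measure, hence almost sure convergence along a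
  -- deterministic sequence `ns → t₀`.
  obtain ⟨ns, hns, hae⟩ := (tendstoInMeasure_of_tendsto_eLpNorm two_ne_zero hfm
    aestronglyMeasurable_zero hflim).exists_seq_tendsto_ae'
  have hne : ∀ᶠ i in atTop, ns i ≠ t₀ := hns.eventually self_mem_nhdsWithin
  have hN : ∀ᶠ i in atTop, HasLaw (fun ω => (W (ns i) ω - W t₀ ω) / √|(ns i : ℝ) - t₀|)
      (gaussianReal 0 1) μ := hne.mono fun i hi => hW.hasLaw_increment_div_sqrt hi
  have hatom : gaussianReal 0 1 {0} = 0 :=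
    (nullSingletonClass_gaussianReal one_ne_zero).measure_singleton 0
  filter_upwards [hae, hξ0, ae_not_tendsto_zero_of_hasLaw hatom hN] with ω h1 h2 h3 hω hcon
  refine h3 ?_
  have h4 : Tendsto (fun i => (Z (ns i) ω - Z t₀ ω) / √|(ns i : ℝ) - t₀|) atTop (𝓝 0) := by
    rw [tendsto_zero_iff_abs_tendsto_zero]
    refine (hcon.comp hns).congr fun i => ?_
    simp only [Function.comp_apply, abs_div, Real.sqrt_eq_rpow]
    rw [abs_of_nonneg (a := |(ns i : ℝ) - t₀| ^ (1 / 2 : ℝ)) (by positivity)]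
  -- The Brownian quotient is recovered as `ξ⁻¹` times the quotient of `Z` minus the freezing error.
  have h5 := ((h4.sub h1).const_mul (ξ ω)⁻¹)
  simp only [Pi.zero_apply, sub_zero, mul_zero] at h5
  refine h5.congr fun i => ?_
  simp only [hf, Set.indicator_of_mem hω]
  have := h2 hω
  field_simp
  ring

end

/-! ### Computing the exponent, nondegeneracy of `Φ (X t₀)`, and tame events. -/

section

theorem limsup_coe_eq_zero_iff {T : Type*} {l : Filter T} [l.NeBot] {f : T → ℝ}
    (hf : ∀ x, 0 ≤ f x) : limsup (fun x => (f x : EReal)) l = 0 ↔ Tendsto f l (𝓝 0) := by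
  constructor
  · intro h
    have : Tendsto (fun x => (f x : EReal)) l (𝓝 ((0 : ℝ) : EReal)) := by
      refine tendsto_of_le_liminf_of_limsup_le ?_ (by simpa using h.le)
      exact le_liminf_of_le (by isBoundedDefault) (Eventually.of_forall fun x =>
        EReal.coe_le_coe_iff.2 (hf x))
    exact EReal.tendsto_coe.1 this
  · intro h
    exact (EReal.tendsto_coe.2 h).limsup_eq

/-- An admissible `ρ > 1/2` would make order `1/2` admissible as well. From below, the countable
family `1/2 - 1/(n + 2)` lets almost sure statements be combined; it starts at `0`, so it stays in
`[0, 1]`. -/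
theorem pointwiseHolderExponent_eq_half {y : unitInterval → ℝ} {t₀ : unitInterval}
    (hle : ∀ n : ℕ, Tendsto (fun s : unitInterval =>
      |y s - y t₀| / |(s : ℝ) - t₀| ^ (1 / 2 - 1 / ((n : ℝ) + 2))) (𝓝[≠] t₀) (𝓝 0))
    (hnot : ¬ Tendsto (fun s : unitInterval => |y s - y t₀| / |(s : ℝ) - t₀| ^ (1 / 2 : ℝ))
      (𝓝[≠] t₀) (𝓝 0)) :
    pointwiseHolderExponent y t₀ = 1 / 2 := by
  have hiff : ∀ ρ : ℝ, limsup (fun s : unitInterval =>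
      ((|y s - y t₀| / |(s : ℝ) - (t₀ : ℝ)| ^ ρ : ℝ) : EReal)) (𝓝[≠] t₀) = 0 ↔
      Tendsto (fun s : unitInterval => |y s - y t₀| / |(s : ℝ) - t₀| ^ ρ) (𝓝[≠] t₀) (𝓝 0) :=
    fun ρ => limsup_coe_eq_zero_iff fun s => by positivity
  unfold pointwiseHolderExponent
  simp only [hiff]
  have hn : ∀ n : ℕ, (0 : ℝ) < 1 / ((n : ℝ) + 2) ∧ 1 / ((n : ℝ) + 2) ≤ 1 / 2 := fun n =>
    ⟨by positivity, one_div_le_one_div_of_le two_pos (by linarith [Nat.cast_nonneg (α := ℝ) n])⟩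
  refine le_antisymm (csSup_le ⟨_, ⟨?_, ?_⟩, hle 0⟩ ?_) ?_
  · linarith [(hn 0).2]
  · linarith [(hn 0).1]
  · rintro ρ ⟨-, hρ⟩
    by_contra! hlt
    refine hnot ?_
    have h := ((tendsto_abs_sub_nhdsNE t₀).rpow_const (p := ρ - 1 / 2)
      (Or.inr (by linarith))).mul hρ
    rw [mul_zero] at h
    refine h.congr' ?_
    filter_upwards [eventually_nhdsNE_abs_sub_pos t₀] with s hs
    rw [Real.rpow_sub hs]
    field_simp
  · have hlim : Tendsto (fun n : ℕ => 1 / 2 - 1 / ((n : ℝ) + 2)) atTop (𝓝 (1 / 2 - 0)) := by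
      refine tendsto_const_nhds.sub ?_
      simp_rw [one_div]
      exact tendsto_inv_atTop_zero.comp
        (tendsto_atTop_add_const_right _ _ tendsto_natCast_atTop_atTop)
    rw [sub_zero] at hlim
    refine le_of_tendsto' hlim fun n => le_csSup ⟨1, fun ρ hρ => hρ.1.2⟩ ⟨⟨?_, ?_⟩, hle n⟩
    · linarith [(hn n).2]
    · linarith [(hn n).1]

variable {Ω : Type*} {mΩ : MeasurableSpace Ω} {μ : Measure Ω}

/-- Positive variance makes the law of `Y` absolutely continuous with respect to Lebesgue measure.
-/
theorem ae_comp_ne_zero_of_gaussian {Y : Ω → ℝ} (hY : HasGaussianLaw Y μ)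
    (hmean : ∫ ω, Y ω ∂μ = 0) (hvar : 0 < ∫ ω, |Y ω| ^ 2 ∂μ) {Φ : ℝ → ℝ}
    (hΦ : volume {x : ℝ | Φ x = 0} = 0) : ∀ᵐ ω ∂μ, Φ (Y ω) ≠ 0 := by
  have hmap := hY.map_eq_gaussianReal
  have hV : Var[Y; μ] = ∫ ω, |Y ω| ^ 2 ∂μ := by
    rw [variance_eq_integral hY.aemeasurable, hmean]
    simp
  have hv : (Var[Y; μ]).toNNReal ≠ 0 := by
    rw [hV]
    exact (Real.toNNReal_pos.2 hvar).ne'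
  have hvol : ∀ᵐ x : ℝ, Φ x ≠ 0 := by
    rw [ae_iff]
    simpa using hΦ
  have h : ∀ᵐ x ∂(μ.map Y), Φ x ≠ 0 := by
    rw [hmap]
    exact (gaussianReal_absolutelyContinuous _ hv).ae_le hvol
  exact ae_of_ae_map hY.aemeasurable h

theorem abs_sub_le_of_abs_deriv_le {Φ : ℝ → ℝ} (hΦ : Differentiable ℝ Φ) {M K : ℝ}
    (hM : ∀ x, |x| ≤ K → |deriv Φ x| ≤ M) {x y : ℝ} (hx : |x| ≤ K) (hy : |y| ≤ K) :
    |Φ x - Φ y| ≤ M * |x - y| :=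
  (convex_Icc (-K) K).norm_image_sub_le_of_norm_deriv_le (fun z _ => hΦ z)
    (fun z hz => hM z (abs_le.2 hz)) (abs_le.1 hy) (abs_le.1 hx)

variable {X W : unitInterval → Ω → ℝ}

/-- The event that `X` is bounded by `K` and `α`-Hölder at `t₀` with constant `K`, along a
countable dense set of times. -/
def tameEvent (X : unitInterval → Ω → ℝ) (α : ℝ) (t₀ : unitInterval) (K : ℝ) : Set Ω :=
  {ω | ∀ i : ℕ, |X (TopologicalSpace.denseSeq unitInterval i) ω| ≤ K ∧
    |X (TopologicalSpace.denseSeq unitInterval i) ω - X t₀ ω| ≤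
      K * |(TopologicalSpace.denseSeq unitInterval i : ℝ) - t₀| ^ α}

theorem measurable_enlargedFiltration (hXm : ∀ s, Measurable (X s)) (hWm : ∀ s, Measurable (W s))
    (s t : unitInterval) : Measurable[enlargedFiltration X W hXm hWm t] (X s) := by
  refine Measurable.mono (measurable_iff_comap_le.2 le_rfl) (le_trans ?_
    (le_sup_left : _ ≤ enlargedFiltration X W hXm hWm t)) le_rfl
  exact le_iSup (fun i => MeasurableSpace.comap (X i) inferInstance) s

theorem measurableSet_tameEvent {m : MeasurableSpace Ω} (hX : ∀ s, Measurable[m] (X s)) (α : ℝ)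
    (t₀ : unitInterval) (K : ℝ) : MeasurableSet[m] (tameEvent X α t₀ K) := by
  have : tameEvent X α t₀ K = ⋂ i : ℕ,
      {ω | |X (TopologicalSpace.denseSeq unitInterval i) ω| ≤ K} ∩
      {ω | |X (TopologicalSpace.denseSeq unitInterval i) ω - X t₀ ω| ≤
        K * |(TopologicalSpace.denseSeq unitInterval i : ℝ) - t₀| ^ α} := by
    ext ω
    simp [tameEvent]
  rw [this]
  refine MeasurableSet.iInter fun i => MeasurableSet.inter ?_ ?_
  · exact measurableSet_le (continuous_abs.measurable.comp (hX _)) measurable_const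
  · exact measurableSet_le (continuous_abs.measurable.comp ((hX _).sub (hX _))) measurable_const

/-- For a continuous path both bounds are closed conditions on `u`, so they extend from the dense
sequence. -/
theorem forall_of_mem_tameEvent {α : ℝ} (hα : 0 < α) {t₀ : unitInterval} {K : ℝ} {ω : Ω}
    (hc : Continuous fun s => X s ω) (hω : ω ∈ tameEvent X α t₀ K) (u : unitInterval) :
    |X u ω| ≤ K ∧ |X u ω - X t₀ ω| ≤ K * |(u : ℝ) - t₀| ^ α := by
  have hpow : Continuous fun u : unitInterval => K * |(u : ℝ) - t₀| ^ α :=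
    continuous_const.mul ((by fun_prop : Continuous fun u : unitInterval =>
      |(u : ℝ) - t₀|).rpow_const fun _ => Or.inr hα.le)
  have hclosed : IsClosed {u : unitInterval | |X u ω| ≤ K ∧
      |X u ω - X t₀ ω| ≤ K * |(u : ℝ) - t₀| ^ α} :=
    (isClosed_le hc.abs continuous_const).inter
      (isClosed_le (hc.sub continuous_const).abs hpow)
  refine hclosed.closure_subset_iff.2 ?_ (TopologicalSpace.denseRange_denseSeq unitInterval u)
  rintro _ ⟨i, rfl⟩
  exact hω i

theorem continuous_of_holder {α : ℝ} (hα : 0 < α) {x : unitInterval → ℝ} {C : ℝ}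
    (h : ∀ s t : unitInterval, |x s - x t| ≤ C * |(s : ℝ) - t| ^ α) : Continuous x := by
  refine continuous_iff_continuousAt.2 fun t => ?_
  rw [ContinuousAt, tendsto_iff_dist_tendsto_zero]
  have hc : Continuous fun s : unitInterval => C * |(s : ℝ) - t| ^ α :=
    continuous_const.mul ((by fun_prop : Continuous fun u : unitInterval =>
      |(u : ℝ) - t|).rpow_const fun _ => Or.inr hα.le)
  have hlim := hc.tendsto t
  rw [sub_self, abs_zero, Real.zero_rpow hα.ne', mul_zero] at hlim
  exact squeeze_zero (fun _ => dist_nonneg) (fun s => h s t) hlim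

theorem exists_mem_tameEvent {α : ℝ} (hα : 0 < α) (t₀ : unitInterval) {ω : Ω} {C : ℝ}
    (h : ∀ s t : unitInterval, |X s ω - X t ω| ≤ C * |(s : ℝ) - t| ^ α) :
    ∃ K : ℕ, ω ∈ tameEvent X α t₀ K := by
  -- `K` must dominate the Hölder constant and, since `|u - t₀| ≤ 1`, also `|X t₀| + |C|`, which
  -- bounds the path; `C` carries no sign assumption.
  obtain ⟨K, hK⟩ := exists_nat_ge (|X t₀ ω| + |C|)
  have hCK : |C| ≤ K := (le_add_of_nonneg_left (abs_nonneg _)).trans hK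
  refine ⟨K, fun i => ?_⟩
  set u := TopologicalSpace.denseSeq unitInterval i
  have hd : |(u : ℝ) - t₀| ≤ 1 := by
    rw [abs_le]
    constructor <;> linarith [u.2.1, u.2.2, t₀.2.1, t₀.2.2]
  have hp0 : 0 ≤ |(u : ℝ) - t₀| ^ α := by positivity
  have hp1 : |(u : ℝ) - t₀| ^ α ≤ 1 := Real.rpow_le_one (abs_nonneg _) hd hα.le
  have hu : |X u ω - X t₀ ω| ≤ |C| * |(u : ℝ) - t₀| ^ α :=
    (h u t₀).trans (mul_le_mul_of_nonneg_right (le_abs_self C) hp0)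
  refine ⟨?_, hu.trans (mul_le_mul_of_nonneg_right hCK hp0)⟩
  have h1 : |X u ω| ≤ |X u ω - X t₀ ω| + |X t₀ ω| := by
    simpa using abs_add_le (X u ω - X t₀ ω) (X t₀ ω)
  have h2 : |C| * |(u : ℝ) - t₀| ^ α ≤ |C| := mul_le_of_le_one_right (abs_nonneg _) hp1
  linarith

end

end StochVol

end

/-! ### Assembly over the countable family of tame events. -/

theorem theorem2 {Ω : Type*} {mΩ : MeasurableSpace Ω} (μ : Measure Ω) [IsProbabilityMeasure μ]
    -- the centered Gaussian process `X`, with Hölder continuous trajectories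
    (X : unitInterval → Ω → ℝ) (hXm : ∀ s, Measurable (X s))
    (hXgauss : IsGaussianProcess X μ) (hXcent : ∀ s, ∫ ω, X s ω ∂μ = 0)
    (α : ℝ) (hα : α ∈ Set.Ioc (1 / 2 : ℝ) 1)
    (hXholder : ∀ᵐ ω ∂μ, ∃ C : ℝ, ∀ s₁ s₂ : unitInterval,
      |X s₁ ω - X s₂ ω| ≤ C * |(s₁ : ℝ) - (s₂ : ℝ)| ^ α)
    -- the standard Brownian motion `W`, independent of `X`
    (W : unitInterval → Ω → ℝ) (hWm : ∀ s, Measurable (W s))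
    (hW : StochVol.IsStandardBrownianMotion W μ)
    (hXW : IndepFun (fun ω s => X s ω) (fun ω s => W s ω) μ)
    -- the function `Φ`
    (Φ : ℝ → ℝ) (hΦ : ContDiff ℝ 1 Φ)
    (c L : ℝ) (hc : 0 < c) (hL : 0 < L)
    (hΦgrowth : ∀ x, |Φ x| + |deriv Φ x| ≤ c * (1 + |x|) ^ L)
    (hΦzero : volume {x : ℝ | Φ x = 0} = 0)
    -- a modification of the process `∫₀ᵗ Φ (X s) dW s` with almost surely continuous trajectories
    (Z : unitInterval → Ω → ℝ)
    (hZ : StochVol.IsItoIntegral (StochVol.enlargedFiltration X W hXm hWm) μ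
      (fun s ω => Φ (X s ω)) W Z)
    (hZcont : ∀ᵐ ω ∂μ, Continuous (fun t => Z t ω)) :
    ∀ t₀ : unitInterval, 0 < ∫ ω, |X t₀ ω| ^ 2 ∂μ →
      ∀ᵐ ω ∂μ, StochVol.pointwiseHolderExponent (fun t => Z t ω) t₀ = 1 / 2 := by
  intro t₀ ht₀
  have hα0 : 0 < α := by linarith [hα.1]
  set ℱ := StochVol.enlargedFiltration X W hXm hWm
  have hWℱ : StochVol.IsBrownianRelativeTo ℱ W μ := hW.isBrownianRelativeTo hXm hWm hXW
  have hXℱ : ∀ s, Measurable[ℱ 0] (X s) := fun s =>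
    StochVol.measurable_enlargedFiltration hXm hWm s 0
  have hΦ0 : ∀ᵐ ω ∂μ, Φ (X t₀ ω) ≠ 0 := StochVol.ae_comp_ne_zero_of_gaussian
    (hXgauss.hasGaussianLaw_eval t₀) (hXcent t₀) ht₀ hΦzero
  have key : ∀ᵐ ω ∂μ, ∀ K : ℕ, ω ∈ StochVol.tameEvent X α t₀ K →
      StochVol.pointwiseHolderExponent (fun t => Z t ω) t₀ = 1 / 2 := by
    refine ae_all_iff.2 fun K => ?_
    set B := StochVol.tameEvent X α t₀ (K : ℝ)
    -- One constant bounds both `Φ` and its derivative on `[-K, K]`.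
    set M := c * (1 + (K : ℝ)) ^ L
    have hM0 : 0 ≤ M := by positivity
    have hM : ∀ x : ℝ, |x| ≤ K → |Φ x| ≤ M ∧ |deriv Φ x| ≤ M := fun x hx => by
      have h1 : c * (1 + |x|) ^ L ≤ M := by
        refine mul_le_mul_of_nonneg_left (Real.rpow_le_rpow (by positivity) ?_ hL.le) hc.le
        linarith
      have h2 := hΦgrowth x
      constructor <;> linarith [abs_nonneg (Φ x), abs_nonneg (deriv Φ x)]
    have hB : MeasurableSet[ℱ 0] B := StochVol.measurableSet_tameEvent hXℱ α t₀ K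
    have hXB : ∀ᵐ ω ∂μ, ω ∈ B → ∀ u : unitInterval,
        |X u ω| ≤ K ∧ |X u ω - X t₀ ω| ≤ K * |(u : ℝ) - t₀| ^ α := by
      filter_upwards [hXholder] with ω ⟨C, hC⟩ hω
      exact StochVol.forall_of_mem_tameEvent hα0 (StochVol.continuous_of_holder hα0 hC) hω
    have hHbound : ∀ᵐ ω ∂μ, ω ∈ B → ∀ u, |Φ (X u ω)| ≤ M := by
      filter_upwards [hXB] with ω h hω u using (hM _ (h hω u).1).1
    -- Truncation makes the frozen value bounded for every `ω`; almost surely on `B` it changes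
    -- nothing.
    set ξ : Ω → ℝ := {ω | |X t₀ ω| ≤ K}.indicator fun ω => Φ (X t₀ ω) with hξdef
    have hξ : Measurable[ℱ 0] ξ := (hΦ.continuous.measurable.comp (hXℱ t₀)).indicator
      (measurableSet_le (continuous_abs.measurable.comp (hXℱ t₀)) measurable_const)
    have hξM : ∀ ω, |ξ ω| ≤ M := fun ω => by
      by_cases h : |X t₀ ω| ≤ K
      · simpa [hξdef, Set.indicator_of_mem (show ω ∈ {ω | |X t₀ ω| ≤ K} from h)] using (hM _ h).1
      · simpa [hξdef, Set.indicator_of_notMem (show ω ∉ {ω | |X t₀ ω| ≤ K} from h)] using hM0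
    have hξB : ∀ᵐ ω ∂μ, ω ∈ B → ξ ω = Φ (X t₀ ω) := by
      filter_upwards [hXB] with ω h hω
      exact Set.indicator_of_mem (show ω ∈ {ω | |X t₀ ω| ≤ K} from (h hω t₀).1) _
    have hHclose : ∀ᵐ ω ∂μ, ω ∈ B → ∀ u : unitInterval,
        |Φ (X u ω) - ξ ω| ≤ M * K * |(u : ℝ) - t₀| ^ α := by
      filter_upwards [hXB, hξB] with ω h h' hω u
      rw [h' hω, mul_assoc]
      exact (StochVol.abs_sub_le_of_abs_deriv_le (hΦ.differentiable one_ne_zero)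
        (fun x hx => (hM x hx).2) (h hω u).1 (h hω t₀).1).trans
        (mul_le_mul_of_nonneg_left (h hω u).2 hM0)
    have hξ0 : ∀ᵐ ω ∂μ, ω ∈ B → ξ ω ≠ 0 := by
      filter_upwards [hξB, hΦ0] with ω h h' hω
      rw [h hω]
      exact h'
    have hupper : ∀ᵐ ω ∂μ, ∀ n : ℕ, ω ∈ B → Tendsto (fun s : unitInterval =>
        |Z s ω - Z t₀ ω| / |(s : ℝ) - t₀| ^ (1 / 2 - 1 / ((n : ℝ) + 2))) (𝓝[≠] t₀) (𝓝 0) := by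
      refine ae_all_iff.2 fun n => hZ.ae_tendsto_holder_quotient hWℱ hZcont hB hHbound t₀ ?_ ?_
      · have : 1 / ((n : ℝ) + 2) ≤ 1 / 2 :=
          one_div_le_one_div_of_le two_pos (by linarith [Nat.cast_nonneg (α := ℝ) n])
        linarith
      · have : 0 < 1 / ((n : ℝ) + 2) := by positivity
        linarith
    filter_upwards [hupper, hZ.ae_not_tendsto_quotient hWℱ hB hξ hξM (by positivity) hα0 hHclose
      hξ0] with ω h1 h2 hω
    exact StochVol.pointwiseHolderExponent_eq_half (fun n => h1 n hω) (h2 hω)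
  filter_upwards [key, hXholder] with ω h ⟨C, hC⟩
  obtain ⟨K, hK⟩ := StochVol.exists_mem_tameEvent hα0 t₀ hC
  exact h K hK
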